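/- Let $m\ge 1$, $n\ge 2$, $A\in\mathbb R^{m\times n}$ with linearly independent rows, $b\in\mathbb R^m$, $c\in\mathbb R^n$ with $Ac=0$. Suppose that the linear program $\min\{c^\top x: Ax=b,\ x\ge 0\}$ has a unique optimal solution $x^\star$ and that its dual $\max\{b^\top y: A^\top y+s=c,\ s\ge 0\}$ has a unique optimal solution $(y^\star,s^\star)$; put $w^\star=(x^\star,s^\star)$. Let $\Theta=\{i: x^\star_i>0\}$ be the optimal basis, $\bar\Theta$ its complement, and let $B=A_\Theta$ and $N=A_{\bar\Theta}$ be the submatrices of $A$ with columns in $\Theta$ and $\bar\Theta$. Let $\lambda_{\max}$ and $\lambda_{\min}$ be the largest and the smallest nonzero singular value of $A$, $\kappa=\lambda_{\max}/\lambda_{\min}$, $\xi=\min_i\{x_i^\star+s_i^\star\}$, and $$\Phi=(\|x^\star\|_1+\|s^\star\|_1)\cdot\max\Big\{\max_{j\in\bar\Theta}\frac{\sqrt{\|(B^{-1}N)_{\cdot,j}\|^2+1}}{s^\star_j},\ \max_{i\in\Theta}\frac{\sqrt{\|(B^{-1}N)_{i,\cdot}\|^2+1}}{x^\star_i}\Big\}$$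 (an empty maximum is omitted). Norms without index are Euclidean for vectors and spectral for matrices. For $\tau,\sigma>0$, one PDHG iteration maps $z=(x,y)$ to $(x^+,y^+)$ with $x^+=\max\{x-\tau(c-A^\top y),0\}$ (componentwise) and $y^+=y+\sigma(b-A(2x^+-x))$. Let $\|z\|_M=\sqrt{z^\top Mz}$ with $M=\begin{pmatrix}\frac1\tau I&-A^\top\\-A&\frac1\sigma I\end{pmatrix}$, let $L(x,y)=c^\top x+b^\top y-(Ax)^\top y$, and for $r>0$ let $\rho(r;z)=\frac1r\sup\{L(x,\hat y)-L(\hat x,y):\hat x\ge0,\ \|(\hat x,\hat y)-z\|_M\le r\}$ (at a saddle point of $L$ put $\rho(0;z)=0$). Restarted PDHG (rPDHG) starts with $z^{0,0}=(0,0)$. The inner loop number $N=0,1,2,\dots$ starts at $z^{N,0}$ and produces PDHG iterates $z^{N,1},z^{N,2},\dots$ and the averages $\bar z^{N,k}=\frac1k\sum_{i=1}^kz^{N,i}$; it stops at the first $k\ge1$ for which either $N=0$ and $k=1$, or $\rho(\|\bar z^{N,k}-z^{N,0}\|_M;\bar z^{N,k})\le\beta\,\rho(\|z^{N,0}-z^{N-1,0}\|_M;z^{N,0})$,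 and then $z^{N+1,0}=\bar z^{N,k}$. Write $z^{N,0}=(x^{N,0},y^{N,0})$ and $w^{N,0}=(x^{N,0},c-A^\top y^{N,0})$; $w$ is called $\varepsilon$-optimal if $\|w-w^\star\|\le\varepsilon$. Run rPDHG with $\tau=\frac1{2\kappa}$, $\sigma=\frac1{2\lambda_{\max}\lambda_{\min}}$, $\beta=1/e$. Then $B$ is invertible, all inner loops terminate, and there are absolute constants $C_1,C_2>0$ (independent of the problem, of its dimensions and of $\varepsilon$) such that, with $T_{basis}=C_1\,\kappa\Phi\ln(\kappa\Phi)$, the following hold. (1) There is an $N_1$ such that for all $N\ge N_1$ the positive components of $x^{N,0}$ are exactly those indexed by $\Theta$, and, for the smallest such $N_1$, the total number $T_1$ of PDHG iterations performed until $z^{N_1,0}$ is obtained satisfies $T_1\le T_{basis}$. (2) For every $\varepsilon>0$ there is a first $N_2$ for which $w^{N_2,0}$ is $\varepsilon$-optimal, and the total number $T_2$ of PDHG iterations performed until $z^{N_2,0}$ is obtained satisfies $$T_2\le T_{basis}+T_{local},\qquad T_{local}=C_2\,\|B^{-1}\|\,\|A\|\cdot\max\Big\{0,\ \ln\frac{\xi}{\varepsilon}\Big\}.$$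 -/

import Mathlib

open scoped Matrix

/-- The Euclidean norm of a finite real vector. -/
noncomputable def euclidNorm {ι : Type*} [Fintype ι] (v : ι → ℝ) : ℝ :=
  ‖(WithLp.toLp 2 v : EuclideanSpace ℝ ι)‖

/-- The linear map `v ↦ D v` between Euclidean spaces; its norm is the spectral norm of `D`. -/
noncomputable def matrixCLM {ι κ : Type*} [Fintype ι] [DecidableEq ι] [Fintype κ] [DecidableEq κ]
    (D : Matrix ι κ ℝ) : EuclideanSpace ℝ κ →L[ℝ] EuclideanSpace ℝ ι :=
  LinearMap.toContinuousLinearMap (Matrix.toLpLin 2 2 D)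

/-- The data of a linear program in standard form, `min cᵀx` subject to `A x = b`, `x ≥ 0`. -/
structure StdLP (m n : ℕ) where
  /-- constraint matrix -/
  A : Matrix (Fin m) (Fin n) ℝ
  /-- right-hand side -/
  b : Fin m → ℝ
  /-- objective vector -/
  c : Fin n → ℝ

namespace StdLP

variable {m n : ℕ}

/-! ### Optimal solutions -/

/-- The feasible set of the primal problem. -/
def primalFeasible (P : StdLP m n) : Set (Fin n → ℝ) :=
  {x | P.A *ᵥ x = P.b ∧ ∀ i, 0 ≤ x i}

/-- The set of optimal solutions of the primal problem `min cᵀx`. -/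
def primalOptimal (P : StdLP m n) : Set (Fin n → ℝ) :=
  {x | x ∈ P.primalFeasible ∧ ∀ x' ∈ P.primalFeasible, P.c ⬝ᵥ x ≤ P.c ⬝ᵥ x'}

/-- The feasible set of the dual problem, in the variables `(y, s)`. -/
def dualFeasible (P : StdLP m n) : Set ((Fin m → ℝ) × (Fin n → ℝ)) :=
  {p | P.Aᵀ *ᵥ p.1 + p.2 = P.c ∧ ∀ i, 0 ≤ p.2 i}

/-- The set of optimal solutions `(y, s)` of the dual problem `max bᵀy`. -/
def dualOptimal (P : StdLP m n) : Set ((Fin m → ℝ) × (Fin n → ℝ)) :=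
  {p | p ∈ P.dualFeasible ∧ ∀ p' ∈ P.dualFeasible, P.b ⬝ᵥ p'.1 ≤ P.b ⬝ᵥ p.1}

/-- The pair `w = (x, s)` as a point of the Euclidean space `ℝ²ⁿ`. -/
noncomputable def pairW (x s : Fin n → ℝ) : EuclideanSpace ℝ (Fin n ⊕ Fin n) :=
  WithLp.toLp 2 (Sum.elim x s)

/-- The set `W⋆ = X⋆ × S⋆` of pairs of a primal optimal `x` and a dual optimal slack `s`. -/
def optimalPairs (P : StdLP m n) : Set (EuclideanSpace ℝ (Fin n ⊕ Fin n)) :=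
  {w | ∃ x ∈ P.primalOptimal, ∃ p ∈ P.dualOptimal, w = pairW x p.2}

/-- `w` is `ε`-optimal if its Euclidean distance to `W⋆` is at most `ε`. -/
def IsEpsOptimal (P : StdLP m n) (ε : ℝ) (w : EuclideanSpace ℝ (Fin n ⊕ Fin n)) : Prop :=
  Metric.infDist w P.optimalPairs ≤ ε

/-! ### Condition numbers -/

/-- The set of nonzero singular values of `A`. -/
def nonzeroSingularValues (P : StdLP m n) : Set ℝ :=
  {t | t ≠ 0 ∧ ∃ i : ℕ, (Matrix.toLpLin 2 2 P.A).singularValues i = t}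

/-- The largest nonzero singular value of `A`. -/
noncomputable def lamMax (P : StdLP m n) : ℝ := sSup P.nonzeroSingularValues

/-- The smallest nonzero singular value of `A`. -/
noncomputable def lamMin (P : StdLP m n) : ℝ := sInf P.nonzeroSingularValues

/-- The matrix condition number `κ` of `A`. -/
noncomputable def kappa (P : StdLP m n) : ℝ := P.lamMax / P.lamMin

/-- The index set `Θ = {i | 0 < x i}` of the positive components of `x`. -/
noncomputable def posSupport (x : Fin n → ℝ) : Finset (Fin n) :=
  Finset.univ.filter fun i => 0 < x i

/-- The linear map of the submatrix `B` of `A` with the columns indexed by `Θ`. -/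
noncomputable def basisMap (P : StdLP m n) (Θ : Finset (Fin n)) :
    EuclideanSpace ℝ Θ →L[ℝ] EuclideanSpace ℝ (Fin m) :=
  matrixCLM (P.A.submatrix id (fun i : Θ => (i : Fin n)))

/-- The inverse `B⁻¹` (the zero map if `B` is not invertible). -/
noncomputable def basisInv (P : StdLP m n) (Θ : Finset (Fin n)) :
    EuclideanSpace ℝ (Fin m) →L[ℝ] EuclideanSpace ℝ Θ :=
  (P.basisMap Θ).inverse

/-- The matrix `B⁻¹ N`, where `N` consists of the columns of `A` outside `Θ`. -/
noncomputable def tableau (P : StdLP m n) (Θ : Finset (Fin n)) :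
    Matrix Θ {j : Fin n // j ∉ Θ} ℝ :=
  Matrix.of fun i j => P.basisInv Θ (WithLp.toLp 2 fun r => P.A r (j : Fin n)) i

/-- The geometric condition number `Φ`, for optimal solutions `x`, `s` with optimal basis
`Θ = {i | 0 < x i}`. A maximum over an empty index set is `0`. -/
noncomputable def Phi (P : StdLP m n) (x s : Fin n → ℝ) : ℝ :=
  ((∑ i, |x i|) + ∑ i, |s i|) *
    max
      (⨆ j : {j : Fin n // j ∉ posSupport x},
        √(euclidNorm (fun i => P.tableau (posSupport x) i j) ^ 2 + 1) / s j)
      (⨆ i : posSupport x,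
        √(euclidNorm (fun j => P.tableau (posSupport x) i j) ^ 2 + 1) / x i)

/-- The smallest component `ξ` of `x + s`. -/
noncomputable def xi (x s : Fin n → ℝ) : ℝ := ⨅ i, (x i + s i)

/-! ### The restarted primal-dual hybrid gradient method -/

/-- The Lagrangian `L(x, y) = cᵀx + bᵀy - (A x)ᵀy`. -/
def lagrangian (P : StdLP m n) (x : Fin n → ℝ) (y : Fin m → ℝ) : ℝ :=
  P.c ⬝ᵥ x + P.b ⬝ᵥ y - (P.A *ᵥ x) ⬝ᵥ y

/-- One PDHG iteration with step-sizes `τ`, `σ`. -/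
noncomputable def onePDHG (P : StdLP m n) (τ σ : ℝ) (z : (Fin n → ℝ) × (Fin m → ℝ)) :
    (Fin n → ℝ) × (Fin m → ℝ) :=
  let x' : Fin n → ℝ := fun i => max ((z.1 - τ • (P.c - P.Aᵀ *ᵥ z.2)) i) 0
  (x', z.2 + σ • (P.b - P.A *ᵥ ((2 : ℝ) • x' - z.1)))

/-- The average `(1/k) ∑_{i=1}^k zⁱ` of the first `k` PDHG iterates started at `z⁰ = z`. -/
noncomputable def avgPDHG (P : StdLP m n) (τ σ : ℝ) (z : (Fin n → ℝ) × (Fin m → ℝ)) (k : ℕ) :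
    (Fin n → ℝ) × (Fin m → ℝ) :=
  (1 / (k : ℝ)) • ∑ i ∈ Finset.Icc 1 k, (P.onePDHG τ σ)^[i] z

/-- The matrix `M` with blocks `(1/τ) I`, `-Aᵀ`, `-A`, `(1/σ) I`. -/
noncomputable def matM (P : StdLP m n) (τ σ : ℝ) : Matrix (Fin n ⊕ Fin m) (Fin n ⊕ Fin m) ℝ :=
  Matrix.fromBlocks ((1 / τ) • 1) (-P.Aᵀ) (-P.A) ((1 / σ) • 1)

/-- `‖z‖_M = √(zᵀ M z)`. -/
noncomputable def normM (P : StdLP m n) (τ σ : ℝ) (z : (Fin n → ℝ) × (Fin m → ℝ)) : ℝ :=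
  √(Sum.elim z.1 z.2 ⬝ᵥ (P.matM τ σ *ᵥ Sum.elim z.1 z.2))

/-- The normalized duality gap `ρ(r; z)`, for `r > 0`. In the algorithm the radius `r = 0` occurs
only at saddle points, where the value `0` given by this formula is the right one. -/
noncomputable def normalizedGap (P : StdLP m n) (τ σ : ℝ) (r : ℝ)
    (z : (Fin n → ℝ) × (Fin m → ℝ)) : ℝ :=
  (1 / r) * sSup {g | ∃ z' : (Fin n → ℝ) × (Fin m → ℝ),
    (∀ i, 0 ≤ z'.1 i) ∧ P.normM τ σ (z' - z) ≤ r ∧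
      g = P.lagrangian z.1 z'.2 - P.lagrangian z'.1 z.2}

/-- The `β`-restart condition after `k` inner iterations of the `N`-th outer loop, which starts at
`z = z^{N,0}`; for `1 ≤ N`, `zprev` is `z^{N-1,0}`. -/
def RestartCondition (P : StdLP m n) (τ σ β : ℝ) (N : ℕ)
    (zprev z : (Fin n → ℝ) × (Fin m → ℝ)) (k : ℕ) : Prop :=
  (N = 0 ∧ k = 1) ∨
    P.normalizedGap τ σ (P.normM τ σ (P.avgPDHG τ σ z k - z)) (P.avgPDHG τ σ z k) ≤
      β * P.normalizedGap τ σ (P.normM τ σ (z - zprev)) z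

/-- The number of PDHG iterations of the `N`-th inner loop: the first `k ≥ 1` at which the restart
condition holds. -/
noncomputable def loopLength (P : StdLP m n) (τ σ β : ℝ) (N : ℕ)
    (zprev z : (Fin n → ℝ) × (Fin m → ℝ)) : ℕ :=
  sInf {k | 1 ≤ k ∧ P.RestartCondition τ σ β N zprev z k}

/-- The pair `(z^{N-1,0}, z^{N,0})` of successive outer iterates, started at `z^{0,0} = (0, 0)`.
The first entry is a dummy for `N = 0`. Once a saddle point is reached, the sequence stays there. -/
noncomputable def outerPair (P : StdLP m n) (τ σ β : ℝ) :
    ℕ → ((Fin n → ℝ) × (Fin m → ℝ)) × ((Fin n → ℝ) × (Fin m → ℝ))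
  | 0 => (0, 0)
  | N + 1 =>
    let p := outerPair P τ σ β N
    (p.2, P.avgPDHG τ σ p.2 (P.loopLength τ σ β N p.1 p.2))

/-- The outer iterate `z^{N,0} = (x^{N,0}, y^{N,0})`. -/
noncomputable def outer (P : StdLP m n) (τ σ β : ℝ) (N : ℕ) : (Fin n → ℝ) × (Fin m → ℝ) :=
  (P.outerPair τ σ β N).2

/-- The pair `w^{N,0} = (x^{N,0}, c - Aᵀ y^{N,0})`. -/
noncomputable def outerW (P : StdLP m n) (τ σ β : ℝ) (N : ℕ) :
    EuclideanSpace ℝ (Fin n ⊕ Fin n) :=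
  pairW (P.outer τ σ β N).1 (P.c - P.Aᵀ *ᵥ (P.outer τ σ β N).2)

/-- The `N`-th inner loop terminates. -/
def LoopTerminates (P : StdLP m n) (τ σ β : ℝ) (N : ℕ) : Prop :=
  ∃ k, 1 ≤ k ∧
    P.RestartCondition τ σ β N (P.outerPair τ σ β N).1 (P.outerPair τ σ β N).2 k

/-- The total number of PDHG iterations performed until `z^{N,0}` is obtained. -/
noncomputable def totalIter (P : StdLP m n) (τ σ β : ℝ) (N : ℕ) : ℕ :=
  ∑ i ∈ Finset.range N,
    P.loopLength τ σ β i (P.outerPair τ σ β i).1 (P.outerPair τ σ β i).2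

end StdLP

/-!
The proof rests on four facts about PDHG on a linear program with unique optima.

* *Sublinear rate.* In the quadratic form `q²‖x‖² + 2 (A x)ᵀy + p²‖y‖²` with `τ = 1/q²`, `σ = 1/p²`,
  one iteration is nonexpansive towards the saddle point, and the duality gap of the average of `k`
  iterates against a test point is at most the form of its difference from the start, divided by
  `2 k` (`gapAt_avgPDHG_le`). This form differs from `‖·‖_M²` in the sign of the mixed term. As
  `‖A‖ = q p / 2`, both are equivalent, with absolute constants, to `q²‖x‖² + p²‖y‖²`, which is all
  that the normalized gap needs. Hence the normalized gap of the average is at most an absolute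
  constant times the distance of the start to the optimum, divided by `k` (`gapBound_avgPDHG`).
* *Global sharpness* (`GapBound.dist_le`). A small normalized gap bounds the primal residual and the
  negative part of the slack, and, through the test point `0`, the gap `cᵀx - bᵀy`. For points in
  the affine space of the equality constraints this gap is `s⋆ᵀx + x⋆ᵀs`, and such a point is
  determined by `x_N` and `s_B`, with edge directions of lengths `√(‖(B⁻¹N)_{·j}‖² + 1)` and
  `√(‖(B⁻¹N)_{i·}‖² + 1)`. So the distance to the optimum is `O(κ Φ)` times the normalized gap.
  Here `A c = 0` serves twice: the correction of the primal residual does not change `cᵀx`, and the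
  norm of `(x⋆, y⋆)` is controlled by `‖x⋆‖₁ + ‖s⋆‖₁`.
* *Local sharpness* (`GapBound.local_dist_le`). On the face `x_N = 0` near the optimum the gap
  controls the residuals of two square systems with matrices `B` and `Bᵀ`, and the constant improves
  to `O(‖B⁻¹‖ ‖A‖)`.
* *Identification* (`avgPDHG_identifies`). Near the optimum one step sets `x_N` to zero.

The sublinear rate together with a sharpness constant `α` bounds the length of every inner loop by
`O(α)`, while the normalized gap drops by the factor `1/e` per loop. `O(ln (κ Φ))` loops of length
`O(κ Φ)` lead to the local phase, in which `ln (ξ / ε)` loops of length `O(‖B⁻¹‖ ‖A‖)` suffice.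

Invertibility of `B` and strict complementarity follow from the uniqueness of the two optima. The
dual certificate comes from separating a compact convex set from a subspace
(`exists_strict_certificate`).
-/

/-! ### Euclidean norms -/

section EuclidNorm

variable {ι κ : Type*} [Fintype ι] [Fintype κ]

theorem euclidNorm_nonneg (v : ι → ℝ) : 0 ≤ euclidNorm v := norm_nonneg _

theorem euclidNorm_sq (v : ι → ℝ) : euclidNorm v ^ 2 = v ⬝ᵥ v := by
  rw [euclidNorm, EuclideanSpace.norm_sq_eq, dotProduct]
  exact Finset.sum_congr rfl fun i _ => by simp [sq]

theorem euclidNorm_add_le (v w : ι → ℝ) : euclidNorm (v + w) ≤ euclidNorm v + euclidNorm w := by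
  simpa [euclidNorm] using norm_add_le (WithLp.toLp 2 v : EuclideanSpace ℝ ι) (WithLp.toLp 2 w)

theorem euclidNorm_sub_le (v w : ι → ℝ) : euclidNorm (v - w) ≤ euclidNorm v + euclidNorm w := by
  simpa [euclidNorm] using norm_sub_le (WithLp.toLp 2 v : EuclideanSpace ℝ ι) (WithLp.toLp 2 w)

theorem euclidNorm_smul (t : ℝ) (v : ι → ℝ) : euclidNorm (t • v) = |t| * euclidNorm v := by
  simpa [euclidNorm] using norm_smul t (WithLp.toLp 2 v : EuclideanSpace ℝ ι)

theorem euclidNorm_neg (v : ι → ℝ) : euclidNorm (-v) = euclidNorm v := by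
  simp [euclidNorm]

theorem euclidNorm_sum_le {α : Type*} (s : Finset α) (v : α → ι → ℝ) :
    euclidNorm (∑ a ∈ s, v a) ≤ ∑ a ∈ s, euclidNorm (v a) := by
  simpa [euclidNorm] using norm_sum_le s fun a => (WithLp.toLp 2 (v a) : EuclideanSpace ℝ ι)

theorem euclidNorm_eq_zero {v : ι → ℝ} : euclidNorm v = 0 ↔ v = 0 := by
  simp [euclidNorm]

theorem abs_le_euclidNorm (v : ι → ℝ) (i : ι) : |v i| ≤ euclidNorm v := by
  simpa [euclidNorm] using PiLp.norm_apply_le (WithLp.toLp 2 v : EuclideanSpace ℝ ι) i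

theorem dotProduct_le_euclidNorm_mul (v w : ι → ℝ) : v ⬝ᵥ w ≤ euclidNorm v * euclidNorm w := by
  have h := real_inner_le_norm (WithLp.toLp 2 w : EuclideanSpace ℝ ι) (WithLp.toLp 2 v)
  simp only [EuclideanSpace.inner_eq_star_dotProduct, star_trivial] at h
  rw [mul_comm]
  exact h

theorem abs_dotProduct_le_euclidNorm_mul (v w : ι → ℝ) :
    |v ⬝ᵥ w| ≤ euclidNorm v * euclidNorm w := by
  refine abs_le.2 ⟨?_, dotProduct_le_euclidNorm_mul v w⟩
  have h := dotProduct_le_euclidNorm_mul (-v) w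
  rw [neg_dotProduct, euclidNorm_neg] at h
  linarith

theorem euclidNorm_le_sum_abs (v : ι → ℝ) : euclidNorm v ≤ ∑ i, |v i| := by
  rw [← abs_of_nonneg (euclidNorm_nonneg v),
    ← abs_of_nonneg (Finset.sum_nonneg fun i _ => abs_nonneg (v i)), ← sq_le_sq, euclidNorm_sq,
    dotProduct]
  simpa [sq] using Finset.sum_sq_le_sq_sum_of_nonneg (s := Finset.univ) (f := fun i => |v i|)
    (fun i _ => abs_nonneg (v i))

theorem euclidNorm_sumElim_sq (v : ι → ℝ) (w : κ → ℝ) :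
    euclidNorm (Sum.elim v w) ^ 2 = euclidNorm v ^ 2 + euclidNorm w ^ 2 := by
  simp only [euclidNorm_sq, sumElim_dotProduct_sumElim]

/-- A bound for the spectral norm of a matrix is one for its transpose. -/
theorem euclidNorm_transpose_mulVec_le {D : Matrix ι κ ℝ} {C : ℝ} (hC : 0 ≤ C)
    (h : ∀ v, euclidNorm (D *ᵥ v) ≤ C * euclidNorm v) (u : ι → ℝ) :
    euclidNorm (Dᵀ *ᵥ u) ≤ C * euclidNorm u := by
  have h1 : euclidNorm (Dᵀ *ᵥ u) ^ 2 ≤ euclidNorm u * (C * euclidNorm (Dᵀ *ᵥ u)) := by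
    calc euclidNorm (Dᵀ *ᵥ u) ^ 2 = u ⬝ᵥ (D *ᵥ (Dᵀ *ᵥ u)) := by
          rw [euclidNorm_sq, Matrix.dotProduct_mulVec u D, ← Matrix.mulVec_transpose]
      _ ≤ _ := (dotProduct_le_euclidNorm_mul _ _).trans
          (mul_le_mul_of_nonneg_left (h _) (euclidNorm_nonneg _))
  rcases (euclidNorm_nonneg (Dᵀ *ᵥ u)).eq_or_lt with h0 | h0
  · rw [← h0]; exact mul_nonneg hC (euclidNorm_nonneg _)
  · nlinarith

end EuclidNorm

/-! ### Extreme singular values -/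

namespace LinearMap

variable {E F : Type*} [NormedAddCommGroup E] [InnerProductSpace ℝ E] [FiniteDimensional ℝ E]
  [NormedAddCommGroup F] [InnerProductSpace ℝ F] [FiniteDimensional ℝ F] (T : E →ₗ[ℝ] F)

theorem norm_apply_sq_eq_sum_singularValues (x : E) :
    ‖T x‖ ^ 2 = ∑ i : Fin (Module.finrank ℝ E), T.singularValues i ^ 2 *
      (T.isSymmetric_adjoint_comp_self.eigenvectorBasis rfl).repr x i ^ 2 := by
  set hT := T.isSymmetric_adjoint_comp_self
  have h1 : ‖T x‖ ^ 2 = inner ℝ ((adjoint T ∘ₗ T) x) x := by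
    rw [comp_apply, adjoint_inner_left, real_inner_self_eq_norm_sq]
  rw [h1, ← (hT.eigenvectorBasis rfl).sum_inner_mul_inner]
  refine Finset.sum_congr rfl fun i _ => ?_
  have h2 := hT.eigenvectorBasis_apply_self_apply rfl x i
  rw [OrthonormalBasis.repr_apply_apply] at h2
  rw [real_inner_comm, h2, T.sq_singularValues_fin rfl, OrthonormalBasis.repr_apply_apply]
  simp [sq, mul_assoc]

theorem norm_adjoint_apply_sq_eq_sum_singularValues (x : E) :
    ‖adjoint T (T x)‖ ^ 2 = ∑ i : Fin (Module.finrank ℝ E), (T.singularValues i ^ 2) ^ 2 *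
      (T.isSymmetric_adjoint_comp_self.eigenvectorBasis rfl).repr x i ^ 2 := by
  set hT := T.isSymmetric_adjoint_comp_self
  rw [← (hT.eigenvectorBasis rfl).repr.norm_map, EuclideanSpace.norm_sq_eq]
  refine Finset.sum_congr rfl fun i _ => ?_
  have h2 := hT.eigenvectorBasis_apply_self_apply rfl x i
  rw [comp_apply] at h2
  rw [h2, T.sq_singularValues_fin rfl]
  simp [mul_pow]

theorem norm_apply_le_of_singularValues_le {L : ℝ} (hL : ∀ i, T.singularValues i ≤ L) (x : E) :
    ‖T x‖ ≤ L * ‖x‖ := by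
  have hL0 : 0 ≤ L := (T.singularValues_nonneg 0).trans (hL 0)
  refine le_of_sq_le_sq ?_ (by positivity)
  rw [norm_apply_sq_eq_sum_singularValues, mul_pow,
    ← (T.isSymmetric_adjoint_comp_self.eigenvectorBasis rfl).repr.norm_map x,
    EuclideanSpace.norm_sq_eq, Finset.mul_sum]
  refine Finset.sum_le_sum fun i _ => ?_
  have := T.singularValues_nonneg i
  have := hL i
  rw [Real.norm_eq_abs, sq_abs]
  gcongr

/-- For `y = T x` the squared norms of `y` and of the image of `y` under the adjoint are weighted
sums with the weights `σᵢ²` and `σᵢ⁴`, so the zero singular values do not matter. -/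
theorem le_norm_adjoint_of_le_singularValues {l : ℝ} (hl0 : 0 ≤ l)
    (hl : ∀ i, T.singularValues i ≠ 0 → l ≤ T.singularValues i)
    (hT : Function.Surjective T) (y : F) : l * ‖y‖ ≤ ‖adjoint T y‖ := by
  obtain ⟨x, rfl⟩ := hT y
  refine le_of_sq_le_sq ?_ (norm_nonneg _)
  rw [mul_pow, norm_apply_sq_eq_sum_singularValues, norm_adjoint_apply_sq_eq_sum_singularValues,
    Finset.mul_sum]
  refine Finset.sum_le_sum fun i _ => ?_
  rw [← mul_assoc]
  refine mul_le_mul_of_nonneg_right ?_ (sq_nonneg _)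
  by_cases h : T.singularValues i = 0
  · simp [h]
  · rw [sq (T.singularValues i ^ 2)]
    have := hl i h
    gcongr

theorem singularValues_le_of_norm_apply_le {C : ℝ} (hC : 0 ≤ C) (h : ∀ x, ‖T x‖ ≤ C * ‖x‖)
    (i : ℕ) : T.singularValues i ≤ C := by
  by_cases! hi : Module.finrank ℝ E ≤ i
  · rw [T.singularValues_of_finrank_le hi]; exact hC
  refine le_of_sq_le_sq ?_ hC
  set b := T.isSymmetric_adjoint_comp_self.eigenvectorBasis rfl
  have h1 := h (b ⟨i, hi⟩)
  rw [b.norm_eq_one, mul_one] at h1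
  have h2 := T.norm_apply_sq_eq_sum_singularValues (b ⟨i, hi⟩)
  rw [Finset.sum_eq_single ⟨i, hi⟩] at h2
  · rw [OrthonormalBasis.repr_self] at h2
    simp at h2
    rw [← h2]
    gcongr
  · intro j _ hj
    rw [OrthonormalBasis.repr_self]
    simp [hj]
  · simp

end LinearMap

namespace StdLP

variable {m n : ℕ} (P : StdLP m n)

theorem nonzeroSingularValues_finite : P.nonzeroSingularValues.Finite := by
  refine ((Matrix.toLpLin 2 2 P.A).singularValues.hasFiniteSupport.image
    (Matrix.toLpLin 2 2 P.A).singularValues).subset ?_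
  rintro t ⟨h0, i, rfl⟩
  exact ⟨i, h0, rfl⟩

theorem toLpLin_surjective (hrows : LinearIndependent ℝ P.A.row) :
    Function.Surjective (Matrix.toLpLin 2 2 P.A) := by
  have h := hrows.rank_matrix
  rw [Matrix.rank] at h
  have h2 : LinearMap.range P.A.mulVecLin = ⊤ :=
    Submodule.eq_top_of_finrank_eq (by rw [h]; simp)
  intro y
  obtain ⟨x, hx⟩ := LinearMap.range_eq_top.1 h2 (WithLp.ofLp y)
  exact ⟨WithLp.toLp 2 x, by rw [Matrix.toLpLin_apply]; exact congrArg (WithLp.toLp 2) hx⟩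

theorem nonzeroSingularValues_nonempty (hm : 1 ≤ m) (hrows : LinearIndependent ℝ P.A.row) :
    P.nonzeroSingularValues.Nonempty := by
  by_contra h
  have h0 : Matrix.toLpLin 2 2 P.A = 0 := by
    rw [← LinearMap.singularValues_eq_zero_iff]
    ext i
    by_contra h1
    exact h ⟨_, h1, i, rfl⟩
  obtain ⟨x, hx⟩ := P.toLpLin_surjective hrows (EuclideanSpace.single ⟨0, hm⟩ 1)
  rw [h0] at hx
  have := congrArg norm hx
  simp at this

theorem lamMin_mem (hm : 1 ≤ m) (hrows : LinearIndependent ℝ P.A.row) :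
    P.lamMin ∈ P.nonzeroSingularValues :=
  (P.nonzeroSingularValues_nonempty hm hrows).csInf_mem P.nonzeroSingularValues_finite

theorem lamMin_pos (hm : 1 ≤ m) (hrows : LinearIndependent ℝ P.A.row) : 0 < P.lamMin := by
  obtain ⟨h0, i, hi⟩ := P.lamMin_mem hm hrows
  rw [← hi] at h0 ⊢
  exact (LinearMap.singularValues_pos_iff_ne_zero _ i).2 h0

theorem lamMin_le_lamMax (hm : 1 ≤ m) (hrows : LinearIndependent ℝ P.A.row) :
    P.lamMin ≤ P.lamMax :=
  le_csSup P.nonzeroSingularValues_finite.bddAbove (P.lamMin_mem hm hrows)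

theorem euclidNorm_mulVec_le_lamMax (hm : 1 ≤ m) (hrows : LinearIndependent ℝ P.A.row)
    (x : Fin n → ℝ) : euclidNorm (P.A *ᵥ x) ≤ P.lamMax * euclidNorm x := by
  refine (Matrix.toLpLin 2 2 P.A).norm_apply_le_of_singularValues_le (fun i => ?_)
    (WithLp.toLp 2 x)
  by_cases h : (Matrix.toLpLin 2 2 P.A).singularValues i = 0
  · rw [h]
    exact (P.lamMin_pos hm hrows).le.trans (P.lamMin_le_lamMax hm hrows)
  · exact le_csSup P.nonzeroSingularValues_finite.bddAbove ⟨h, i, rfl⟩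

theorem lamMin_mul_euclidNorm_le (hm : 1 ≤ m) (hrows : LinearIndependent ℝ P.A.row)
    (y : Fin m → ℝ) : P.lamMin * euclidNorm y ≤ euclidNorm (P.Aᵀ *ᵥ y) := by
  have h := (Matrix.toLpLin 2 2 P.A).le_norm_adjoint_of_le_singularValues
    (P.lamMin_pos hm hrows).le (fun i h => csInf_le P.nonzeroSingularValues_finite.bddBelow
      ⟨h, i, rfl⟩) (P.toLpLin_surjective hrows) (WithLp.toLp 2 y)
  have h2 := Matrix.toEuclideanLin_conjTranspose_eq_adjoint P.A
  rw [Matrix.toEuclideanLin] at h2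
  rw [← h2, Matrix.conjTranspose_eq_transpose_of_trivial] at h
  exact h

theorem lamMax_le_norm (hm : 1 ≤ m) (hrows : LinearIndependent ℝ P.A.row) :
    P.lamMax ≤ ‖matrixCLM P.A‖ := by
  refine csSup_le (P.nonzeroSingularValues_nonempty hm hrows) ?_
  rintro t ⟨_, i, rfl⟩
  exact LinearMap.singularValues_le_of_norm_apply_le _ (norm_nonneg _)
    (fun x => (matrixCLM P.A).le_opNorm x) i

/-! ### Strict complementarity and the optimal basis -/

theorem exists_pos_forall_add_mul_nonneg {ι : Type*} [Finite ι] (x d : ι → ℝ)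
    (h : ∀ i, 0 < x i ∨ 0 ≤ x i ∧ 0 ≤ d i) : ∃ t : ℝ, 0 < t ∧ ∀ i, 0 ≤ x i + t * d i := by
  have h1 : ∀ᶠ t in nhdsWithin (0 : ℝ) (Set.Ioi 0), ∀ i, 0 ≤ x i + t * d i := by
    rw [Filter.eventually_all]
    intro i
    rcases h i with hi | ⟨hi, hd⟩
    · have hc : Filter.Tendsto (fun t : ℝ => x i + t * d i) (nhdsWithin 0 (Set.Ioi 0))
          (nhds (x i + 0 * d i)) :=
        (Continuous.tendsto (by fun_prop) 0).mono_left nhdsWithin_le_nhds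
      rw [zero_mul, add_zero] at hc
      exact (hc.eventually (lt_mem_nhds hi)).mono fun t ht => ht.le
    · filter_upwards [self_mem_nhdsWithin] with t ht
      exact add_nonneg hi (mul_nonneg (le_of_lt ht) hd)
  obtain ⟨t, ht, ht0⟩ := (h1.and self_mem_nhdsWithin).exists
  exact ⟨t, ht0, ht⟩

variable {P}

/-- At a unique primal optimum no nonzero feasible direction is nonincreasing. -/
theorem direction_eq_zero {xs : Fin n → ℝ} (hx : P.primalOptimal = {xs}) {d : Fin n → ℝ}
    (hA : P.A *ᵥ d = 0) (hc : P.c ⬝ᵥ d ≤ 0) (hd : ∀ i, ¬ 0 < xs i → 0 ≤ d i) : d = 0 := by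
  have hxs : xs ∈ P.primalOptimal := by rw [hx]; rfl
  obtain ⟨t, ht, hpos⟩ := exists_pos_forall_add_mul_nonneg xs d fun i => by
    by_cases h : 0 < xs i
    · exact Or.inl h
    · exact Or.inr ⟨hxs.1.2 i, hd i h⟩
  have hmem : xs + t • d ∈ P.primalOptimal := by
    refine ⟨⟨?_, fun i => by simpa using hpos i⟩, fun x' hx' => ?_⟩
    · rw [Matrix.mulVec_add, Matrix.mulVec_smul, hA, hxs.1.1, smul_zero, add_zero]
    · refine le_trans ?_ (hxs.2 x' hx')
      rw [dotProduct_add, dotProduct_smul, smul_eq_mul]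
      nlinarith
  rw [hx, Set.mem_singleton_iff, add_eq_left, smul_eq_zero] at hmem
  exact hmem.resolve_left ht.ne'

/-- A unique primal optimum has a dual certificate that is strictly complementary to it. The
certificate is a hyperplane separating the compact convex hull of the points `(A_j, c_j)` with
`xs j = 0` and of `(0, 1)` from the span of the points `(A_i, c_i)` with `0 < xs i`. -/
theorem exists_strict_certificate {xs : Fin n → ℝ} (hx : P.primalOptimal = {xs}) :
    ∃ y : Fin m → ℝ, (∀ i, 0 < xs i → (P.c - P.Aᵀ *ᵥ y) i = 0) ∧
      ∀ i, ¬ 0 < xs i → 0 < (P.c - P.Aᵀ *ᵥ y) i := by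
  classical
  let g : (Fin n → ℝ) →ₗ[ℝ] (Fin m → ℝ) × ℝ :=
    { toFun := fun d => (P.A *ᵥ d, P.c ⬝ᵥ d)
      map_add' := fun u v => by simp [Matrix.mulVec_add, dotProduct_add]
      map_smul' := fun t u => by simp [Matrix.mulVec_smul, dotProduct_smul] }
  let V : Submodule ℝ (Fin n → ℝ) :=
    { carrier := {v | ∀ i, ¬ 0 < xs i → v i = 0}
      add_mem' := fun {u v} hu hv i hi => by simp [hu i hi, hv i hi]
      zero_mem' := fun i _ => rfl
      smul_mem' := fun t u hu i hi => by simp [hu i hi] }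
  let h : (Option (Fin n) → ℝ) →ₗ[ℝ] (Fin m → ℝ) × ℝ :=
    { toFun := fun w => g (fun i => w (some i)) + (0, w none)
      map_add' := fun u v => by
        have : (fun i => (u + v) (some i)) = (fun i => u (some i)) + fun i => v (some i) := rfl
        rw [this, map_add]
        ext
        · simp
        · simp; ring
      map_smul' := fun t u => by
        have : (fun i => (t • u) (some i)) = t • fun i => u (some i) := rfl
        rw [this, map_smul]
        ext <;> simp }
  let S : Set (Option (Fin n) → ℝ) :=
    stdSimplex ℝ (Option (Fin n)) ∩ {w | ∀ i, 0 < xs i → w (some i) = 0}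
  have hSc : Convex ℝ S := by
    refine (convex_stdSimplex ℝ _).inter ?_
    intro u hu v hv a b _ _ _ i hi
    simp [hu i hi, hv i hi]
  have hSk : IsCompact S := by
    refine (isCompact_stdSimplex ℝ _).inter_right ?_
    simp only [Set.ofPred_forall]
    exact isClosed_iInter fun i => isClosed_iInter fun _ =>
      isClosed_eq (continuous_apply _) continuous_const
  -- a common point yields a feasible direction along which `cᵀx` does not increase
  have hdisj : Disjoint (h '' S) (V.map g : Set ((Fin m → ℝ) × ℝ)) := by
    rw [Set.disjoint_left]
    rintro _ ⟨w, hw, rfl⟩ ⟨v, hv, hvw⟩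
    have h1 : P.A *ᵥ v = P.A *ᵥ (fun i => w (some i)) := by
      simpa [h, g] using congrArg Prod.fst hvw
    have h2 : P.c ⬝ᵥ v = P.c ⬝ᵥ (fun i => w (some i)) + w none := by
      simpa [h, g] using congrArg Prod.snd hvw
    have h0 := hw.1.1 none
    have hz : (fun i => w (some i)) - v = 0 := by
      refine direction_eq_zero hx ?_ ?_ ?_
      · rw [Matrix.mulVec_sub, h1, sub_self]
      · rw [dotProduct_sub]; linarith
      · intro i hi
        have := hv i hi
        have h3 := hw.1.1 (some i)
        simp only [Pi.sub_apply, this, sub_zero]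
        exact h3
    have hwz : ∀ i, w (some i) = 0 := fun i => by
      by_cases hi : 0 < xs i
      · exact hw.2 i hi
      · have := congrFun hz i
        simpa [hv i hi] using this
    have hsum := hw.1.2
    rw [Fintype.sum_option] at hsum
    have hwv : (fun i => w (some i)) = v := sub_eq_zero.1 hz
    rw [hwv] at h2
    simp only [hwz, Finset.sum_const_zero, add_zero] at hsum
    linarith
  obtain ⟨f, u, v, hfu, huv, hvf⟩ := geometric_hahn_banach_compact_closed
    (hSc.linear_image h) (hSk.image h.continuous_of_finiteDimensional)
    (V.map g).convex (V.map g).closed_of_finiteDimensional hdisj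
  have hv0 : v < 0 := by simpa using hvf 0 (V.map g).zero_mem
  -- a functional bounded below on a subspace vanishes there
  have hfV : ∀ d ∈ V, f (g d) = 0 := by
    intro d hd
    by_contra hne
    have h1 := hvf (g ((v / f (g d)) • d)) ⟨_, V.smul_mem _ hd, rfl⟩
    rw [map_smul, map_smul, smul_eq_mul, div_mul_cancel₀ _ hne] at h1
    exact lt_irrefl _ h1
  have hfS : ∀ w ∈ S, f (h w) < 0 := fun w hw => (hfu _ ⟨w, hw, rfl⟩).trans (huv.trans hv0)
  set γ := f (0, 1) with hγ
  let p : Fin m → ℝ := fun r => f (Pi.single r 1, 0)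
  have hfe : ∀ (a : Fin m → ℝ) (t : ℝ), f (a, t) = a ⬝ᵥ p + t * γ := by
    intro a t
    have h1 : (a, t) = (∑ r, a r • ((Pi.single r 1 : Fin m → ℝ), (0 : ℝ))) + t • (0, 1) := by
      ext i
      · simp [Prod.fst_sum, Finset.sum_apply, Pi.single_apply]
      · simp [Prod.snd_sum]
    rw [h1, map_add, map_sum, map_smul, smul_eq_mul]
    simp only [map_smul, smul_eq_mul]
    rfl
  have hγ0 : γ < 0 := by
    have := hfS (Pi.single none 1) ⟨single_mem_stdSimplex ℝ none, fun i _ => by simp⟩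
    have h2 : h (Pi.single none 1) = (0, 1) := by
      have : (fun i : Fin n => (Pi.single none 1 : Option (Fin n) → ℝ) (some i)) = 0 := by
        ext i; simp
      change g _ + _ = _
      rw [this, map_zero]; simp
    rwa [h2] at this
  have hge : ∀ j, f (g (Pi.single j 1)) = (P.Aᵀ *ᵥ p) j + P.c j * γ := by
    intro j
    have : g (Pi.single j 1) = (P.A.col j, P.c j) := by
      ext <;> simp [g]
    rw [this, hfe]
    rfl
  refine ⟨(-γ)⁻¹ • p, fun i hi => ?_, fun i hi => ?_⟩
  · have h1 := hfV (Pi.single i 1) fun j hj => by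
      have : j ≠ i := by rintro rfl; exact hj hi
      simp [this]
    rw [hge] at h1
    rw [Matrix.mulVec_smul, Pi.sub_apply, Pi.smul_apply, smul_eq_mul]
    have h3 : (P.Aᵀ *ᵥ p) i = -γ * P.c i := by linarith
    rw [h3, inv_mul_cancel_left₀ (by linarith), sub_self]
  · have h1 := hfS (Pi.single (some i) 1) ⟨single_mem_stdSimplex ℝ _, fun j hj => by
      have : j ≠ i := by rintro rfl; exact hi hj
      simp [this]⟩
    have h2 : h (Pi.single (some i) 1) = g (Pi.single i 1) := by
      have : (fun j : Fin n => (Pi.single (some i) 1 : Option (Fin n) → ℝ) (some j)) =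
          Pi.single i 1 := by
        ext j; simp [Pi.single_apply]
      change g _ + _ = _
      rw [this]; simp
    rw [h2, hge] at h1
    rw [Matrix.mulVec_smul, Pi.sub_apply, Pi.smul_apply, smul_eq_mul]
    have h3 : 0 < -γ := by linarith
    have h4 : (-γ)⁻¹ * (P.Aᵀ *ᵥ p) i < P.c i := by
      rw [inv_mul_lt_iff₀ h3]; linarith
    linarith

end StdLP

namespace StdLP

variable {m n : ℕ} {P : StdLP m n}

/-- `xs` and `(ys, ss)` satisfy the equality constraints of the two problems, are nonnegative and
strictly complementary; nonnegativity is part of the field `compl`. -/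
structure IsStrictPair (P : StdLP m n) (xs : Fin n → ℝ) (ys : Fin m → ℝ) (ss : Fin n → ℝ) :
    Prop where
  primal : P.A *ᵥ xs = P.b
  dual : P.Aᵀ *ᵥ ys + ss = P.c
  compl : ∀ i, (0 < xs i ∧ ss i = 0) ∨ (xs i = 0 ∧ 0 < ss i)

theorem dotProduct_mulVec_transpose (x : Fin n → ℝ) (y : Fin m → ℝ) :
    x ⬝ᵥ (P.Aᵀ *ᵥ y) = (P.A *ᵥ x) ⬝ᵥ y := by
  rw [Matrix.mulVec_transpose, dotProduct_comm, ← Matrix.dotProduct_mulVec, dotProduct_comm]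

/-- By weak duality the strictly complementary certificate is a dual optimum, hence the given
one. -/
theorem isStrictPair_of_unique {xs : Fin n → ℝ} {ys : Fin m → ℝ} {ss : Fin n → ℝ}
    (hx : P.primalOptimal = {xs}) (hys : P.dualOptimal = {(ys, ss)}) :
    P.IsStrictPair xs ys ss := by
  obtain ⟨y, h0, h1⟩ := exists_strict_certificate hx
  have hxs : xs ∈ P.primalOptimal := by rw [hx]; rfl
  have hmem : (y, P.c - P.Aᵀ *ᵥ y) ∈ P.dualOptimal := by
    refine ⟨⟨by simp, fun i => ?_⟩, fun p' hp' => ?_⟩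
    · by_cases hi : 0 < xs i
      · exact (h0 i hi).ge
      · exact (h1 i hi).le
    · have e1 : xs ⬝ᵥ (P.c - P.Aᵀ *ᵥ y) = 0 := by
        refine Finset.sum_eq_zero fun i _ => ?_
        by_cases hi : 0 < xs i
        · rw [h0 i hi, mul_zero]
        · rw [le_antisymm (not_lt.1 hi) (hxs.1.2 i), zero_mul]
      have e2 : 0 ≤ xs ⬝ᵥ (P.c - P.Aᵀ *ᵥ p'.1) := by
        refine Finset.sum_nonneg fun i _ => mul_nonneg (hxs.1.2 i) ?_
        rw [← hp'.1]
        simpa using hp'.2 i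
      rw [dotProduct_sub, dotProduct_mulVec_transpose, hxs.1.1] at e1 e2
      linarith
  rw [hys, Set.mem_singleton_iff, Prod.mk.injEq] at hmem
  obtain ⟨rfl, rfl⟩ := hmem
  refine ⟨hxs.1.1, by simp, fun i => ?_⟩
  by_cases hi : 0 < xs i
  · exact Or.inl ⟨hi, h0 i hi⟩
  · exact Or.inr ⟨le_antisymm (not_lt.1 hi) (hxs.1.2 i), h1 i hi⟩

theorem IsStrictPair.dual_eq {xs : Fin n → ℝ} {ys : Fin m → ℝ} {ss : Fin n → ℝ}
    (h : P.IsStrictPair xs ys ss) : P.c - P.Aᵀ *ᵥ ys = ss := by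
  rw [← h.dual]; simp

theorem mem_posSupport {x : Fin n → ℝ} {i : Fin n} : i ∈ posSupport x ↔ 0 < x i := by
  simp [posSupport]

/-- A vector on `Θ`, extended by zero. -/
def extendZero (Θ : Finset (Fin n)) (v : Θ → ℝ) : Fin n → ℝ :=
  fun i => if h : i ∈ Θ then v ⟨i, h⟩ else 0

theorem sum_eq_sum_subtype (Θ : Finset (Fin n)) (f : Fin n → ℝ) :
    ∑ i, f i = ∑ i : Θ, f i + ∑ j : {j : Fin n // j ∉ Θ}, f j :=
  (Fintype.sum_subtype_add_sum_subtype (fun i => i ∈ Θ) f).symm.trans (by congr!)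

@[simp]
theorem extendZero_coe (Θ : Finset (Fin n)) (v : Θ → ℝ) (i : Θ) : extendZero Θ v i = v i := by
  simp [extendZero]

theorem extendZero_of_notMem {Θ : Finset (Fin n)} (v : Θ → ℝ) {j : Fin n} (hj : j ∉ Θ) :
    extendZero Θ v j = 0 := by
  simp [extendZero, hj]

@[simp]
theorem extendZero_coe_compl {Θ : Finset (Fin n)} (v : Θ → ℝ) (j : {j : Fin n // j ∉ Θ}) :
    extendZero Θ v j = 0 :=
  extendZero_of_notMem v j.2

theorem basisMap_apply (Θ : Finset (Fin n)) (v : EuclideanSpace ℝ Θ) :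
    P.basisMap Θ v = WithLp.toLp 2 (P.A *ᵥ extendZero Θ v) := by
  ext r
  change ∑ i : Θ, P.A r i * v i = ∑ i, P.A r i * extendZero Θ v i
  rw [sum_eq_sum_subtype Θ]
  simp

theorem extendZero_restrict {Θ : Finset (Fin n)} {d : Fin n → ℝ} (hd : ∀ i ∉ Θ, d i = 0) :
    extendZero Θ (fun i => d i) = d := by
  ext i
  by_cases h : i ∈ Θ <;> simp [extendZero, h, hd]

theorem euclidNorm_extendZero (Θ : Finset (Fin n)) (v : Θ → ℝ) :
    euclidNorm (extendZero Θ v) = euclidNorm v := by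
  rw [← sq_eq_sq₀ (euclidNorm_nonneg _) (euclidNorm_nonneg _), euclidNorm_sq, euclidNorm_sq,
    dotProduct, sum_eq_sum_subtype Θ]
  simp [dotProduct]

/-- Uniqueness of the primal optimum makes the columns of `B` independent, uniqueness of the dual
optimum makes its rows independent. -/
theorem basisMap_isInvertible {xs : Fin n → ℝ} {ys : Fin m → ℝ} {ss : Fin n → ℝ}
    (hx : P.primalOptimal = {xs}) (hys : P.dualOptimal = {(ys, ss)}) :
    (P.basisMap (posSupport xs)).IsInvertible := by
  classical
  have hst := isStrictPair_of_unique hx hys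
  set Θ := posSupport xs with hΘ
  have hinj : Function.Injective (P.basisMap Θ) := by
    rw [injective_iff_map_eq_zero]
    intro v hv
    rw [basisMap_apply] at hv
    have hA : P.A *ᵥ extendZero Θ v = 0 := congrArg WithLp.ofLp hv
    have hc : P.c ⬝ᵥ extendZero Θ v = 0 := by
      rw [← hst.dual, add_dotProduct, dotProduct_comm, dotProduct_mulVec_transpose, hA,
        zero_dotProduct, zero_add]
      refine Finset.sum_eq_zero fun i _ => ?_
      by_cases h : i ∈ Θ
      · rcases hst.compl i with h1 | h1
        · rw [h1.2, zero_mul]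
        · rw [hΘ, mem_posSupport, h1.1] at h
          exact absurd h (lt_irrefl _)
      · simp [extendZero, h]
    have hz := direction_eq_zero hx hA hc.le fun i hi => by
      rw [← mem_posSupport, ← hΘ] at hi
      simp [extendZero, hi]
    have := euclidNorm_extendZero Θ v
    rw [hz, euclidNorm_eq_zero.2 rfl] at this
    have h2 := euclidNorm_eq_zero.1 this.symm
    ext i
    exact congrFun h2 i
  have hinj2 : ∀ u : Fin m → ℝ, (∀ i ∈ Θ, (P.Aᵀ *ᵥ u) i = 0) → u = 0 := by
    intro u hu
    obtain ⟨t, ht, hpos⟩ := exists_pos_forall_add_mul_nonneg ss (-(P.Aᵀ *ᵥ u)) fun i => by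
      rcases hst.compl i with h | h
      · refine Or.inr ⟨h.2.ge, ?_⟩
        rw [Pi.neg_apply, hu i (mem_posSupport.2 h.1), neg_zero]
      · exact Or.inl h.2
    have hmem : (ys + t • u, ss + t • (-(P.Aᵀ *ᵥ u))) ∈ P.dualOptimal := by
      have hopt : (ys, ss) ∈ P.dualOptimal := by rw [hys]; rfl
      refine ⟨⟨?_, fun i => by simpa using hpos i⟩, fun p' hp' => (hopt.2 p' hp').trans ?_⟩
      · simp only [Matrix.mulVec_add, Matrix.mulVec_smul]
        rw [← hst.dual, smul_neg]
        abel
      · have : P.b ⬝ᵥ u = 0 := by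
          rw [← hst.primal, ← dotProduct_mulVec_transpose]
          refine Finset.sum_eq_zero fun i _ => ?_
          rcases hst.compl i with h | h
          · rw [hu i (mem_posSupport.2 h.1), mul_zero]
          · rw [h.1, zero_mul]
        rw [dotProduct_add, dotProduct_smul, this]
        simp
    rw [hys, Set.mem_singleton_iff, Prod.mk.injEq, add_eq_left, smul_eq_zero] at hmem
    exact hmem.1.resolve_left ht.ne'
  have h1 : Module.finrank ℝ (EuclideanSpace ℝ Θ) ≤ Module.finrank ℝ (EuclideanSpace ℝ (Fin m)) :=
    LinearMap.finrank_le_finrank_of_injective (f := (P.basisMap Θ).toLinearMap) hinj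
  let R : (Fin m → ℝ) →ₗ[ℝ] (Θ → ℝ) :=
    (P.A.submatrix id (fun i : Θ => (i : Fin n)))ᵀ.mulVecLin
  have h2 : Module.finrank ℝ (Fin m → ℝ) ≤ Module.finrank ℝ (Θ → ℝ) := by
    refine LinearMap.finrank_le_finrank_of_injective (f := R) ?_
    rw [injective_iff_map_eq_zero]
    exact fun u hu => hinj2 u fun i hi => congrFun hu ⟨i, hi⟩
  have h3 : Module.finrank ℝ (EuclideanSpace ℝ Θ) =
      Module.finrank ℝ (EuclideanSpace ℝ (Fin m)) := by
    simp at h1 h2 ⊢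
    omega
  have hsurj := (LinearMap.injective_iff_surjective_of_finrank_eq_finrank
    (f := (P.basisMap Θ).toLinearMap) h3).1 hinj
  exact ⟨(LinearEquiv.ofBijective (P.basisMap Θ).toLinearMap ⟨hinj, hsurj⟩).toContinuousLinearEquiv,
    by ext; rfl⟩

/-! ### Error estimates in terms of the basis -/

section Basis

variable {Θ : Finset (Fin n)}

theorem eq_zero_of_mulVec_eq_zero (hB : (P.basisMap Θ).IsInvertible) {d : Fin n → ℝ}
    (hd : ∀ i ∉ Θ, d i = 0) (hA : P.A *ᵥ d = 0) : d = 0 := by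
  have h : P.basisMap Θ (WithLp.toLp 2 fun i => d i) = 0 := by
    rw [basisMap_apply, extendZero_restrict hd, hA]; rfl
  have h2 := hB.injective (h.trans (map_zero _).symm)
  rw [← extendZero_restrict hd]
  ext i
  by_cases hi : i ∈ Θ
  · simpa [extendZero, hi] using congrFun (congrArg WithLp.ofLp h2) ⟨i, hi⟩
  · simp [extendZero, hi]

theorem euclidNorm_le_basisInv_mul (hB : (P.basisMap Θ).IsInvertible) {d : Fin n → ℝ}
    (hd : ∀ i ∉ Θ, d i = 0) :
    euclidNorm d ≤ ‖P.basisInv Θ‖ * euclidNorm (P.A *ᵥ d) := by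
  have h : P.basisInv Θ (WithLp.toLp 2 (P.A *ᵥ d)) = WithLp.toLp 2 fun i : Θ => d i := by
    rw [basisInv, ← hB.inverse_apply_self (WithLp.toLp 2 fun i : Θ => d i), basisMap_apply,
      extendZero_restrict hd]
  have h2 := (P.basisInv Θ).le_opNorm (WithLp.toLp 2 (P.A *ᵥ d))
  rw [h] at h2
  rw [← extendZero_restrict hd, euclidNorm_extendZero, extendZero_restrict hd]
  exact h2

theorem basis_mulVec_basisInv (hB : (P.basisMap Θ).IsInvertible) (u : Fin m → ℝ) :
    P.A *ᵥ extendZero Θ (P.basisInv Θ (WithLp.toLp 2 u)) = u := by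
  have h := hB.self_apply_inverse (WithLp.toLp 2 u)
  rw [basisMap_apply] at h
  exact congrArg WithLp.ofLp h

theorem euclidNorm_le_basisInv_mul_transpose (hB : (P.basisMap Θ).IsInvertible) (u : Fin m → ℝ) :
    euclidNorm u ≤ ‖P.basisInv Θ‖ * euclidNorm (fun i : Θ => (P.Aᵀ *ᵥ u) i) := by
  set v := P.basisInv Θ (WithLp.toLp 2 u) with hv
  have h1 : euclidNorm u ^ 2 = v ⬝ᵥ (fun i : Θ => (P.Aᵀ *ᵥ u) i) := by
    calc euclidNorm u ^ 2 = extendZero Θ v ⬝ᵥ (P.Aᵀ *ᵥ u) := by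
          rw [dotProduct_mulVec_transpose, hv, basis_mulVec_basisInv hB, euclidNorm_sq]
      _ = _ := by
          rw [dotProduct, sum_eq_sum_subtype Θ]
          simp [dotProduct]
  have h2 := dotProduct_le_euclidNorm_mul v (fun i : Θ => (P.Aᵀ *ᵥ u) i)
  have h3 : euclidNorm (v : Θ → ℝ) ≤ ‖P.basisInv Θ‖ * euclidNorm u :=
    (P.basisInv Θ).le_opNorm (WithLp.toLp 2 u)
  have h4 := euclidNorm_nonneg (fun i : Θ => (P.Aᵀ *ᵥ u) i)
  have h5 := mul_le_mul_of_nonneg_right h3 h4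
  rcases (euclidNorm_nonneg u).eq_or_lt with h0 | h0
  · rw [← h0]; positivity
  · nlinarith

/-- The condition number of `B` relative to a bound for `‖A‖` is at least one. -/
theorem one_le_mul_norm_basisInv (hB : (P.basisMap Θ).IsInvertible) (hm : 1 ≤ m) {L : ℝ}
    (hL : ∀ x, euclidNorm (P.A *ᵥ x) ≤ L * euclidNorm x) (hL0 : 0 ≤ L) :
    1 ≤ L * ‖P.basisInv Θ‖ := by
  let u : Fin m → ℝ := Pi.single ⟨0, hm⟩ 1
  have hu : euclidNorm u = 1 := by
    rw [← sq_eq_sq₀ (euclidNorm_nonneg _) zero_le_one, euclidNorm_sq]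
    simp [u]
  have h1 := hL (extendZero Θ (P.basisInv Θ (WithLp.toLp 2 u)))
  rw [basis_mulVec_basisInv hB, hu, euclidNorm_extendZero] at h1
  have h2 : euclidNorm (P.basisInv Θ (WithLp.toLp 2 u) : Θ → ℝ) ≤ ‖P.basisInv Θ‖ * euclidNorm u :=
    (P.basisInv Θ).le_opNorm (WithLp.toLp 2 u)
  rw [hu, mul_one] at h2
  exact h1.trans (mul_le_mul_of_nonneg_left h2 hL0)

theorem sum_mul_tableau (hB : (P.basisMap Θ).IsInvertible) (r : Fin m) (j : {j : Fin n // j ∉ Θ}) :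
    ∑ i : Θ, P.A r i * P.tableau Θ i j = P.A r j := by
  have h := congrFun (basis_mulVec_basisInv hB fun r => P.A r j) r
  rw [Matrix.mulVec, dotProduct, sum_eq_sum_subtype Θ] at h
  simp only [extendZero_coe, extendZero_coe_compl, mul_zero, Finset.sum_const_zero, add_zero] at h
  exact h

/-- A vector of the null space is determined by its nonbasic part `d_N`: it is
`(-B⁻¹ N d_N, d_N)`. -/
theorem euclidNorm_le_sum_nonbasic (hB : (P.basisMap Θ).IsInvertible) {d : Fin n → ℝ}
    (hA : P.A *ᵥ d = 0) :
    euclidNorm d ≤ ∑ j : {j : Fin n // j ∉ Θ},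
      |d j| * √(euclidNorm (fun i => P.tableau Θ i j) ^ 2 + 1) := by
  classical
  let v : {j : Fin n // j ∉ Θ} → Fin n → ℝ := fun j k =>
    if h : k ∈ Θ then -P.tableau Θ ⟨k, h⟩ j else (Pi.single (j : Fin n) (1 : ℝ) : Fin n → ℝ) k
  have hnorm : ∀ j, euclidNorm (v j) = √(euclidNorm (fun i => P.tableau Θ i j) ^ 2 + 1) := by
    intro j
    rw [← Real.sqrt_sq (euclidNorm_nonneg (v j)), euclidNorm_sq, dotProduct,
      sum_eq_sum_subtype Θ, euclidNorm_sq]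
    congr 1
    congr 1
    · simp [v, dotProduct]
    · rw [Finset.sum_eq_single j]
      · simp [v, j.2]
      · intro k _ hk
        have : (k : Fin n) ≠ j := fun h => hk (Subtype.ext h)
        simp [v, k.2, this]
      · simp
  have hAv : ∀ j, P.A *ᵥ v j = 0 := by
    intro j
    ext r
    rw [Matrix.mulVec, dotProduct, sum_eq_sum_subtype Θ, Finset.sum_eq_single (s := Finset.univ) j]
    · simp only [v, Finset.coe_mem, dif_pos, j.2, dif_neg, not_false_eq_true, mul_neg,
        Finset.sum_neg_distrib, Subtype.coe_eta, Pi.single_eq_same, mul_one]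
      rw [sum_mul_tableau hB]
      simp
    · intro k _ hk
      have : (k : Fin n) ≠ j := fun h => hk (Subtype.ext h)
      simp [v, k.2, this]
    · simp
  have hd : d = ∑ j, d (j : {j : Fin n // j ∉ Θ}) • v j := by
    rw [← sub_eq_zero]
    refine eq_zero_of_mulVec_eq_zero hB (fun k hk => ?_) ?_
    · rw [Pi.sub_apply, Finset.sum_apply, Finset.sum_eq_single ⟨k, hk⟩]
      · simp [v, hk]
      · intro j _ hj
        have : k ≠ j := fun h => hj (Subtype.ext h.symm)
        simp [v, hk, this]
      · simp
    · rw [Matrix.mulVec_sub, Matrix.mulVec_sum, hA]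
      simp [Matrix.mulVec_smul, hAv]
  conv_lhs => rw [hd]
  refine (euclidNorm_sum_le _ _).trans (Finset.sum_le_sum fun j _ => ?_)
  rw [euclidNorm_smul, hnorm]

/-- A vector of the row space is determined by its basic part `e_B`: it is
`(e_B, (B⁻¹ N)ᵀ e_B)`. -/
theorem euclidNorm_le_sum_basic (hB : (P.basisMap Θ).IsInvertible) (u : Fin m → ℝ) :
    euclidNorm (P.Aᵀ *ᵥ u) ≤ ∑ i : Θ,
      |(P.Aᵀ *ᵥ u) i| * √(euclidNorm (fun j => P.tableau Θ i j) ^ 2 + 1) := by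
  classical
  let w : Θ → Fin n → ℝ := fun i k =>
    if h : k ∉ Θ then P.tableau Θ i ⟨k, h⟩ else (Pi.single (i : Fin n) (1 : ℝ) : Fin n → ℝ) k
  have hnorm : ∀ i, euclidNorm (w i) = √(euclidNorm (fun j => P.tableau Θ i j) ^ 2 + 1) := by
    intro i
    rw [← Real.sqrt_sq (euclidNorm_nonneg (w i)), euclidNorm_sq, dotProduct,
      sum_eq_sum_subtype Θ, euclidNorm_sq, add_comm]
    congr 1
    congr 1
    · exact Finset.sum_congr rfl fun j _ => by simp [w, j.2]
    · rw [Finset.sum_eq_single i]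
      · simp [w]
      · intro k _ hk
        have : (k : Fin n) ≠ i := fun h => hk (Subtype.ext h)
        simp [w, this]
      · simp
  have hd : P.Aᵀ *ᵥ u = ∑ i : Θ, (P.Aᵀ *ᵥ u) i • w i := by
    ext k
    rw [Finset.sum_apply]
    by_cases hk : k ∈ Θ
    · rw [Finset.sum_eq_single ⟨k, hk⟩]
      · simp [w, hk]
      · intro j _ hj
        have : k ≠ j := fun h => hj (Subtype.ext h.symm)
        simp [w, hk, this]
      · simp
    · simp only [w, hk, not_false_eq_true, dif_pos, Pi.smul_apply, smul_eq_mul]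
      simp only [Matrix.mulVec, dotProduct, Matrix.transpose_apply, Finset.sum_mul]
      rw [Finset.sum_comm]
      refine Finset.sum_congr rfl fun r _ => ?_
      rw [← sum_mul_tableau hB r ⟨k, hk⟩, Finset.sum_mul]
      exact Finset.sum_congr rfl fun i _ => by ring
  conv_lhs => rw [hd]
  refine (euclidNorm_sum_le _ _).trans (Finset.sum_le_sum fun j _ => ?_)
  rw [euclidNorm_smul, hnorm]

end Basis

end StdLP

namespace StdLP

variable {m n : ℕ} {P : StdLP m n} {q p : ℝ}

/-! ### Weighted norms and the duality gap -/

/-- The norm `√(q²‖x‖² + p²‖y‖²)` on pairs `z = (x, y)`. For the step-sizes `τ = 1/q²` and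
`σ = 1/p²` it is equivalent to `‖z‖_M`. -/
noncomputable def wnorm (q p : ℝ) (z : (Fin n → ℝ) × (Fin m → ℝ)) : ℝ :=
  euclidNorm (Sum.elim (q • z.1) (p • z.2))

theorem wnorm_nonneg (z : (Fin n → ℝ) × (Fin m → ℝ)) : 0 ≤ wnorm q p z := euclidNorm_nonneg _

theorem wnorm_sq (z : (Fin n → ℝ) × (Fin m → ℝ)) :
    wnorm q p z ^ 2 = q ^ 2 * euclidNorm z.1 ^ 2 + p ^ 2 * euclidNorm z.2 ^ 2 := by
  rw [wnorm, euclidNorm_sumElim_sq, euclidNorm_smul, euclidNorm_smul, mul_pow, mul_pow, sq_abs,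
    sq_abs]

theorem sumElim_add_smul (z w : (Fin n → ℝ) × (Fin m → ℝ)) :
    (Sum.elim (q • (z + w).1) (p • (z + w).2) : Fin n ⊕ Fin m → ℝ) =
      Sum.elim (q • z.1) (p • z.2) + Sum.elim (q • w.1) (p • w.2) := by
  ext (i | i) <;> simp

theorem wnorm_add_le (z w : (Fin n → ℝ) × (Fin m → ℝ)) :
    wnorm q p (z + w) ≤ wnorm q p z + wnorm q p w := by
  rw [wnorm, sumElim_add_smul]
  exact euclidNorm_add_le _ _

theorem wnorm_smul (t : ℝ) (z : (Fin n → ℝ) × (Fin m → ℝ)) :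
    wnorm q p (t • z) = |t| * wnorm q p z := by
  rw [wnorm, wnorm, ← euclidNorm_smul]
  congr 1
  ext (i | i) <;> simp <;> ring

theorem wnorm_neg (z : (Fin n → ℝ) × (Fin m → ℝ)) : wnorm q p (-z) = wnorm q p z := by
  rw [← neg_one_smul ℝ z, wnorm_smul]; simp

theorem wnorm_sub_comm (z w : (Fin n → ℝ) × (Fin m → ℝ)) :
    wnorm q p (z - w) = wnorm q p (w - z) := by
  rw [← neg_sub, wnorm_neg]

theorem wnorm_sub_le_add (z w u : (Fin n → ℝ) × (Fin m → ℝ)) :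
    wnorm q p (z - u) ≤ wnorm q p (z - w) + wnorm q p (w - u) := by
  rw [← sub_add_sub_cancel z w u]
  exact wnorm_add_le _ _

theorem mul_euclidNorm_fst_le (z : (Fin n → ℝ) × (Fin m → ℝ)) :
    q * euclidNorm z.1 ≤ wnorm q p z := by
  refine le_of_sq_le_sq ?_ (wnorm_nonneg z)
  rw [wnorm_sq, mul_pow]
  nlinarith [mul_nonneg (sq_nonneg p) (sq_nonneg (euclidNorm z.2))]

theorem mul_euclidNorm_snd_le (z : (Fin n → ℝ) × (Fin m → ℝ)) :
    p * euclidNorm z.2 ≤ wnorm q p z := by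
  refine le_of_sq_le_sq ?_ (wnorm_nonneg z)
  rw [wnorm_sq, mul_pow]
  nlinarith [mul_nonneg (sq_nonneg q) (sq_nonneg (euclidNorm z.1))]

theorem eq_zero_of_wnorm_eq_zero (hq : 0 < q) (hp : 0 < p) {z : (Fin n → ℝ) × (Fin m → ℝ)}
    (h : wnorm q p z = 0) : z = 0 := by
  have h1 := mul_euclidNorm_fst_le (q := q) (p := p) z
  have h2 := mul_euclidNorm_snd_le (q := q) (p := p) z
  rw [h] at h1 h2
  have h3 := euclidNorm_nonneg z.1
  have h4 := euclidNorm_nonneg z.2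
  ext1
  · exact euclidNorm_eq_zero.1 (le_antisymm (by nlinarith) h3)
  · exact euclidNorm_eq_zero.1 (le_antisymm (by nlinarith) h4)

/-- The quadratic form `q²‖x‖² + 2 (A x)ᵀy + p²‖y‖²`, in which one iteration is nonexpansive. Its
mixed term has the opposite sign to that of `‖z‖_M²`, since `L` contains `-(A x)ᵀy`. -/
noncomputable def qform (P : StdLP m n) (q p : ℝ) (z : (Fin n → ℝ) × (Fin m → ℝ)) : ℝ :=
  q ^ 2 * (z.1 ⬝ᵥ z.1) + 2 * ((P.A *ᵥ z.1) ⬝ᵥ z.2) + p ^ 2 * (z.2 ⬝ᵥ z.2)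

theorem normM_eq (z : (Fin n → ℝ) × (Fin m → ℝ)) :
    P.normM (1 / q ^ 2) (1 / p ^ 2) z =
      √(q ^ 2 * (z.1 ⬝ᵥ z.1) - 2 * ((P.A *ᵥ z.1) ⬝ᵥ z.2) + p ^ 2 * (z.2 ⬝ᵥ z.2)) := by
  rw [normM, matM, Matrix.fromBlocks_mulVec, sumElim_dotProduct_sumElim]
  congr 1
  simp only [one_div, inv_inv, Matrix.smul_mulVec, Matrix.one_mulVec, Matrix.neg_mulVec,
    dotProduct_add, dotProduct_neg, dotProduct_smul, smul_eq_mul, Sum.elim_comp_inl,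
    Sum.elim_comp_inr, dotProduct_mulVec_transpose, dotProduct_comm z.2 (P.A *ᵥ z.1)]
  ring

theorem normM_smul (t : ℝ) (z : (Fin n → ℝ) × (Fin m → ℝ)) :
    P.normM (1 / q ^ 2) (1 / p ^ 2) (t • z) = |t| * P.normM (1 / q ^ 2) (1 / p ^ 2) z := by
  rw [normM_eq, normM_eq, ← Real.sqrt_sq_eq_abs, ← Real.sqrt_mul (sq_nonneg t)]
  congr 1
  simp only [Prod.smul_fst, Prod.smul_snd, Matrix.mulVec_smul, smul_dotProduct, dotProduct_smul,
    smul_eq_mul]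
  ring

/-- The mixed term is at most half of the square of the weighted norm if `‖A‖ ≤ q p / 2`. -/
theorem abs_mixed_le
    (hA : ∀ x, euclidNorm (P.A *ᵥ x) ≤ q * p / 2 * euclidNorm x)
    (z : (Fin n → ℝ) × (Fin m → ℝ)) :
    |2 * ((P.A *ᵥ z.1) ⬝ᵥ z.2)| ≤ wnorm q p z ^ 2 / 2 := by
  have h1 := abs_dotProduct_le_euclidNorm_mul (P.A *ᵥ z.1) z.2
  have h2 := mul_le_mul_of_nonneg_right (hA z.1) (euclidNorm_nonneg z.2)
  rw [abs_mul, abs_two, wnorm_sq]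
  nlinarith [sq_nonneg (q * euclidNorm z.1 - p * euclidNorm z.2)]

theorem qform_le
    (hA : ∀ x, euclidNorm (P.A *ᵥ x) ≤ q * p / 2 * euclidNorm x)
    (z : (Fin n → ℝ) × (Fin m → ℝ)) : P.qform q p z ≤ 3 / 2 * wnorm q p z ^ 2 := by
  have h := (abs_le.1 (abs_mixed_le hA z)).2
  have h2 := wnorm_sq (q := q) (p := p) z
  rw [euclidNorm_sq, euclidNorm_sq] at h2
  rw [qform]; linarith

theorem le_qform
    (hA : ∀ x, euclidNorm (P.A *ᵥ x) ≤ q * p / 2 * euclidNorm x)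
    (z : (Fin n → ℝ) × (Fin m → ℝ)) : 1 / 2 * wnorm q p z ^ 2 ≤ P.qform q p z := by
  have h := (abs_le.1 (abs_mixed_le hA z)).1
  have h2 := wnorm_sq (q := q) (p := p) z
  rw [euclidNorm_sq, euclidNorm_sq] at h2
  rw [qform]; linarith

theorem wnorm_le_two_mul_of_qform_le
    (hA : ∀ x, euclidNorm (P.A *ᵥ x) ≤ q * p / 2 * euclidNorm x)
    {z w : (Fin n → ℝ) × (Fin m → ℝ)} (h : P.qform q p z ≤ P.qform q p w) :
    wnorm q p z ≤ 2 * wnorm q p w := by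
  have h1 := le_qform hA z
  have h2 := qform_le hA w
  have h3 := wnorm_nonneg (q := q) (p := p) w
  refine le_of_sq_le_sq ?_ (by positivity)
  nlinarith [sq_nonneg (wnorm q p w)]

theorem normM_le_two_mul
    (hA : ∀ x, euclidNorm (P.A *ᵥ x) ≤ q * p / 2 * euclidNorm x)
    (z : (Fin n → ℝ) × (Fin m → ℝ)) :
    P.normM (1 / q ^ 2) (1 / p ^ 2) z ≤ 2 * wnorm q p z := by
  have h := (abs_le.1 (abs_mixed_le hA z)).1
  have h2 := wnorm_sq (q := q) (p := p) z
  rw [euclidNorm_sq, euclidNorm_sq] at h2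
  rw [normM_eq, Real.sqrt_le_iff]
  refine ⟨by have := wnorm_nonneg (q := q) (p := p) z; positivity, ?_⟩
  nlinarith [sq_nonneg (wnorm q p z)]

theorem wnorm_le_two_mul_normM
    (hA : ∀ x, euclidNorm (P.A *ᵥ x) ≤ q * p / 2 * euclidNorm x)
    (z : (Fin n → ℝ) × (Fin m → ℝ)) :
    wnorm q p z ≤ 2 * P.normM (1 / q ^ 2) (1 / p ^ 2) z := by
  have h := (abs_le.1 (abs_mixed_le hA z)).2
  have h2 := wnorm_sq (q := q) (p := p) z
  rw [euclidNorm_sq, euclidNorm_sq] at h2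
  have h3 : wnorm q p z / 2 ≤ P.normM (1 / q ^ 2) (1 / p ^ 2) z := by
    rw [normM_eq]
    refine Real.le_sqrt_of_sq_le ?_
    nlinarith [sq_nonneg (wnorm q p z)]
  linarith

/-- The duality gap `L(x, ŷ) - L(x̂, y)` of `z = (x, y)` against the test point `ẑ = (x̂, ŷ)`. -/
def gapAt (P : StdLP m n) (z z' : (Fin n → ℝ) × (Fin m → ℝ)) : ℝ :=
  P.lagrangian z.1 z'.2 - P.lagrangian z'.1 z.2

theorem gapAt_eq (z z' : (Fin n → ℝ) × (Fin m → ℝ)) :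
    P.gapAt z z' = (P.b - P.A *ᵥ z.1) ⬝ᵥ (z'.2 - z.2) -
      (P.c - P.Aᵀ *ᵥ z.2) ⬝ᵥ (z'.1 - z.1) := by
  simp only [gapAt, lagrangian, sub_dotProduct, dotProduct_sub]
  rw [dotProduct_comm (P.Aᵀ *ᵥ z.2) z'.1, dotProduct_comm (P.Aᵀ *ᵥ z.2) z.1,
    dotProduct_mulVec_transpose, dotProduct_mulVec_transpose]
  ring

theorem gapAt_add_smul (z d : (Fin n → ℝ) × (Fin m → ℝ)) (t : ℝ) :
    P.gapAt z (z + t • d) =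
      t * ((P.b - P.A *ᵥ z.1) ⬝ᵥ d.2 - (P.c - P.Aᵀ *ᵥ z.2) ⬝ᵥ d.1) := by
  rw [gapAt_eq]
  simp [dotProduct_smul, mul_sub]

theorem gapAt_lineMap (z z' : (Fin n → ℝ) × (Fin m → ℝ)) (t : ℝ) :
    P.gapAt z (z + t • (z' - z)) = t * P.gapAt z z' := by
  rw [gapAt_add_smul, gapAt_eq]; simp

/-- The gap against the saddle point is nonnegative for `x ≥ 0`, being `s⋆ᵀx`. -/
theorem gapAt_saddle {xs : Fin n → ℝ} {ys : Fin m → ℝ} {ss : Fin n → ℝ}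
    (hst : P.IsStrictPair xs ys ss) (z : (Fin n → ℝ) × (Fin m → ℝ)) :
    P.gapAt z (xs, ys) = ss ⬝ᵥ z.1 := by
  have h0 : ss ⬝ᵥ xs = 0 := Finset.sum_eq_zero fun i _ => by
    rcases hst.compl i with h | h
    · rw [h.2, zero_mul]
    · rw [h.1, mul_zero]
  have h1 : ∀ x, P.c ⬝ᵥ x = (P.A *ᵥ x) ⬝ᵥ ys + ss ⬝ᵥ x := fun x => by
    rw [← hst.dual, add_dotProduct, dotProduct_comm, dotProduct_mulVec_transpose]
  simp only [gapAt, lagrangian, h1, hst.primal, h0]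
  ring

/-! ### The sublinear rate of averaged PDHG -/

/-- The projection inequality of the primal step and the dual step combine into a descent of the
quadratic form. -/
theorem two_mul_gapAt_onePDHG_le (hq : 0 < q) (hp : 0 < p)
    (hA : ∀ x, euclidNorm (P.A *ᵥ x) ≤ q * p / 2 * euclidNorm x)
    (z z' : (Fin n → ℝ) × (Fin m → ℝ)) (hz' : ∀ i, 0 ≤ z'.1 i) :
    2 * P.gapAt (P.onePDHG (1 / q ^ 2) (1 / p ^ 2) z) z' ≤
      P.qform q p (z' - z) - P.qform q p (z' - P.onePDHG (1 / q ^ 2) (1 / p ^ 2) z) := by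
  set w := P.onePDHG (1 / q ^ 2) (1 / p ^ 2) z with hw
  set s := P.c - P.Aᵀ *ᵥ z.2 with hs
  have hw1 : ∀ i, w.1 i = max ((z.1 - (1 / q ^ 2) • s) i) 0 := fun i => rfl
  have hw2 : w.2 = z.2 + (1 / p ^ 2) • (P.b - P.A *ᵥ ((2 : ℝ) • w.1 - z.1)) := rfl
  -- the projection inequality
  have hproj : 0 ≤ q ^ 2 * ((w.1 - z.1) ⬝ᵥ (z'.1 - w.1)) + s ⬝ᵥ (z'.1 - w.1) := by
    rw [← smul_eq_mul, ← smul_dotProduct, ← add_dotProduct]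
    refine Finset.sum_nonneg fun i _ => ?_
    have h1 := hw1 i
    simp only [Pi.sub_apply, Pi.smul_apply, Pi.add_apply, smul_eq_mul] at h1 ⊢
    have hq2 : q ^ 2 * (1 / q ^ 2 * s i) = s i := by field_simp
    rcases le_total (z.1 i - 1 / q ^ 2 * s i) 0 with h | h
    · rw [max_eq_right h] at h1
      rw [h1, sub_zero]
      refine mul_nonneg ?_ (hz' i)
      nlinarith [sq_nonneg q]
    · rw [max_eq_left h] at h1
      have : q ^ 2 * (w.1 i - z.1 i) + s i = 0 := by rw [h1]; linear_combination -hq2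
      rw [this, zero_mul]
  -- the dual step
  have hdual : P.b - P.A *ᵥ w.1 = p ^ 2 • (w.2 - z.2) + P.A *ᵥ (w.1 - z.1) := by
    rw [hw2, add_sub_cancel_left, smul_smul, mul_one_div_cancel (by positivity), one_smul,
      Matrix.mulVec_sub, Matrix.mulVec_smul, Matrix.mulVec_sub, two_smul]
    abel
  have hs2 : P.c - P.Aᵀ *ᵥ w.2 = s - P.Aᵀ *ᵥ (w.2 - z.2) := by
    rw [hs, Matrix.mulVec_sub]; abel
  have hpos := le_qform hA (w - z)
  have hpos2 := sq_nonneg (wnorm q p (w - z))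
  rw [gapAt_eq, hdual, hs2]
  have hsplit : P.qform q p (z' - z) = P.qform q p (z' - w) + P.qform q p (w - z) +
      2 * (q ^ 2 * ((w.1 - z.1) ⬝ᵥ (z'.1 - w.1)) + (P.A *ᵥ (w.1 - z.1)) ⬝ᵥ (z'.2 - w.2) +
        (P.A *ᵥ (z'.1 - w.1)) ⬝ᵥ (w.2 - z.2) + p ^ 2 * ((w.2 - z.2) ⬝ᵥ (z'.2 - w.2))) := by
    rw [← sub_add_sub_cancel z' w z]
    simp only [qform, Prod.fst_add, Prod.snd_add, Prod.fst_sub, Prod.snd_sub,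
      Matrix.mulVec_add, add_dotProduct, dotProduct_add,
      dotProduct_comm (z'.1 - w.1) (w.1 - z.1), dotProduct_comm (z'.2 - w.2) (w.2 - z.2)]
    ring
  rw [hsplit]
  rw [sub_dotProduct, add_dotProduct, smul_dotProduct, smul_eq_mul,
    dotProduct_comm (P.Aᵀ *ᵥ (w.2 - z.2)), dotProduct_mulVec_transpose]
  linarith

theorem gapAt_avg {ι : Type*} (S : Finset ι) (hS : (S.card : ℝ) ≠ 0)
    (f : ι → (Fin n → ℝ) × (Fin m → ℝ)) (z' : (Fin n → ℝ) × (Fin m → ℝ)) :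
    S.card * P.gapAt ((1 / (S.card : ℝ)) • ∑ i ∈ S, f i) z' = ∑ i ∈ S, P.gapAt (f i) z' := by
  let φ : (Fin n → ℝ) × (Fin m → ℝ) →ₗ[ℝ] ℝ :=
    { toFun := fun z => P.c ⬝ᵥ z.1 - (P.A *ᵥ z.1) ⬝ᵥ z'.2 - P.b ⬝ᵥ z.2 + (P.A *ᵥ z'.1) ⬝ᵥ z.2
      map_add' := fun u v => by
        simp only [Prod.fst_add, Prod.snd_add, dotProduct_add, Matrix.mulVec_add, add_dotProduct]
        ring
      map_smul' := fun t u => by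
        simp only [Prod.smul_fst, Prod.smul_snd, dotProduct_smul, Matrix.mulVec_smul,
          smul_dotProduct, smul_eq_mul, RingHom.id_apply]
        ring }
  have h : ∀ z, P.gapAt z z' = φ z + (P.b ⬝ᵥ z'.2 - P.c ⬝ᵥ z'.1) := fun z => by
    simp only [gapAt, lagrangian, φ, LinearMap.coe_mk, AddHom.coe_mk]; ring
  simp only [h, map_smul, map_sum, Finset.sum_add_distrib, Finset.sum_const, nsmul_eq_mul,
    smul_eq_mul]
  field_simp

theorem qform_convexOn
    (hA : ∀ x, euclidNorm (P.A *ᵥ x) ≤ q * p / 2 * euclidNorm x) :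
    ConvexOn ℝ Set.univ (P.qform q p) := by
  refine ⟨convex_univ, fun u _ v _ a b ha hb hab => ?_⟩
  have h1 : a * P.qform q p u + b * P.qform q p v - P.qform q p (a • u + b • v) =
      a * b * P.qform q p (u - v) := by
    obtain rfl : b = 1 - a := by linarith
    simp only [qform, Prod.fst_add, Prod.snd_add, Prod.smul_fst, Prod.smul_snd, Prod.fst_sub,
      Prod.snd_sub, Matrix.mulVec_add, Matrix.mulVec_sub, Matrix.mulVec_smul, add_dotProduct,
      dotProduct_add, sub_dotProduct, dotProduct_sub, smul_dotProduct, dotProduct_smul,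
      smul_eq_mul, dotProduct_comm v.1 u.1, dotProduct_comm v.2 u.2]
    ring
  have h2 := le_qform hA (u - v)
  have h3 : 0 ≤ P.qform q p (u - v) := le_trans (by positivity) h2
  have := mul_nonneg (mul_nonneg ha hb) h3
  rw [smul_eq_mul, smul_eq_mul]
  linarith

theorem onePDHG_fst_nonneg (τ σ : ℝ) (z : (Fin n → ℝ) × (Fin m → ℝ)) (i : Fin n) :
    0 ≤ (P.onePDHG τ σ z).1 i := le_max_right _ _

theorem iterate_fst_nonneg (τ σ : ℝ) (z : (Fin n → ℝ) × (Fin m → ℝ)) {k : ℕ} (hk : 1 ≤ k)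
    (i : Fin n) : 0 ≤ ((P.onePDHG τ σ)^[k] z).1 i := by
  obtain ⟨j, rfl⟩ := Nat.exists_eq_add_of_le' hk
  rw [Function.iterate_succ_apply']
  exact onePDHG_fst_nonneg τ σ _ i

theorem avgPDHG_fst_apply (τ σ : ℝ) (z : (Fin n → ℝ) × (Fin m → ℝ)) (k : ℕ) (i : Fin n) :
    (P.avgPDHG τ σ z k).1 i =
      1 / (k : ℝ) * ∑ j ∈ Finset.Icc 1 k, ((P.onePDHG τ σ)^[j] z).1 i := by
  simp [avgPDHG, Prod.fst_sum, Finset.sum_apply]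

theorem avgPDHG_fst_nonneg (τ σ : ℝ) (z : (Fin n → ℝ) × (Fin m → ℝ)) (k : ℕ) (i : Fin n) :
    0 ≤ (P.avgPDHG τ σ z k).1 i := by
  rw [avgPDHG_fst_apply]
  exact mul_nonneg (by positivity) (Finset.sum_nonneg fun j hj =>
    iterate_fst_nonneg τ σ z (Finset.mem_Icc.1 hj).1 i)

/-- Telescoping the one-step inequality; the gap is affine in its first argument, so the sum of the
gaps of the iterates is `k` times the gap of their average. -/
theorem gapAt_avgPDHG_le (hq : 0 < q) (hp : 0 < p)
    (hA : ∀ x, euclidNorm (P.A *ᵥ x) ≤ q * p / 2 * euclidNorm x)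
    (z z' : (Fin n → ℝ) × (Fin m → ℝ)) (hz' : ∀ i, 0 ≤ z'.1 i) {k : ℕ} (hk : 1 ≤ k) :
    2 * k * P.gapAt (P.avgPDHG (1 / q ^ 2) (1 / p ^ 2) z k) z' ≤ P.qform q p (z' - z) := by
  have hk0 : ((Finset.Icc 1 k).card : ℝ) ≠ 0 := by
    rw [Nat.card_Icc]; simp; omega
  have h1 := gapAt_avg (P := P) (Finset.Icc 1 k) hk0
    (fun i => (P.onePDHG (1 / q ^ 2) (1 / p ^ 2))^[i] z) z'
  rw [Nat.card_Icc, Nat.add_sub_cancel] at h1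
  rw [avgPDHG, mul_assoc, h1]
  have h2 : ∀ j : ℕ, 2 * ∑ i ∈ Finset.Icc 1 j,
      P.gapAt ((P.onePDHG (1 / q ^ 2) (1 / p ^ 2))^[i] z) z' ≤ P.qform q p (z' - z) -
        P.qform q p (z' - (P.onePDHG (1 / q ^ 2) (1 / p ^ 2))^[j] z) := by
    intro j
    induction j with
    | zero => simp
    | succ j ih =>
      rw [Finset.sum_Icc_succ_top (by omega), mul_add, Function.iterate_succ_apply']
      have := two_mul_gapAt_onePDHG_le hq hp hA
        ((P.onePDHG (1 / q ^ 2) (1 / p ^ 2))^[j] z) z' hz'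
      linarith
  have h3 := le_qform hA (z' - (P.onePDHG (1 / q ^ 2) (1 / p ^ 2))^[k] z)
  have h4 := sq_nonneg (wnorm q p (z' - (P.onePDHG (1 / q ^ 2) (1 / p ^ 2))^[k] z))
  linarith [h2 k]

section Saddle

variable {xs : Fin n → ℝ} {ys : Fin m → ℝ} {ss : Fin n → ℝ}

theorem IsStrictPair.fst_nonneg (h : P.IsStrictPair xs ys ss) (i : Fin n) : 0 ≤ xs i := by
  rcases h.compl i with h | h
  · exact h.1.le
  · exact h.1.ge

theorem IsStrictPair.slack_nonneg (h : P.IsStrictPair xs ys ss) (i : Fin n) : 0 ≤ ss i := by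
  rcases h.compl i with h | h
  · exact h.2.ge
  · exact h.2.le

theorem qform_iterate_le (hq : 0 < q) (hp : 0 < p)
    (hA : ∀ x, euclidNorm (P.A *ᵥ x) ≤ q * p / 2 * euclidNorm x)
    (hst : P.IsStrictPair xs ys ss) (z : (Fin n → ℝ) × (Fin m → ℝ)) (k : ℕ) :
    P.qform q p ((xs, ys) - (P.onePDHG (1 / q ^ 2) (1 / p ^ 2))^[k] z) ≤
      P.qform q p ((xs, ys) - z) := by
  induction k with
  | zero => simp
  | succ k ih =>
    rw [Function.iterate_succ_apply']
    have h1 := two_mul_gapAt_onePDHG_le hq hp hA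
      ((P.onePDHG (1 / q ^ 2) (1 / p ^ 2))^[k] z) (xs, ys) hst.fst_nonneg
    rw [gapAt_saddle hst] at h1
    have h2 : 0 ≤ ss ⬝ᵥ (P.onePDHG (1 / q ^ 2) (1 / p ^ 2)
        ((P.onePDHG (1 / q ^ 2) (1 / p ^ 2))^[k] z)).1 :=
      Finset.sum_nonneg fun i _ => mul_nonneg (hst.slack_nonneg i) (onePDHG_fst_nonneg _ _ _ i)
    linarith

theorem qform_avgPDHG_le (hq : 0 < q) (hp : 0 < p)
    (hA : ∀ x, euclidNorm (P.A *ᵥ x) ≤ q * p / 2 * euclidNorm x)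
    (hst : P.IsStrictPair xs ys ss) (z : (Fin n → ℝ) × (Fin m → ℝ)) {k : ℕ} (hk : 1 ≤ k) :
    P.qform q p ((xs, ys) - P.avgPDHG (1 / q ^ 2) (1 / p ^ 2) z k) ≤
      P.qform q p ((xs, ys) - z) := by
  have hk0 : (k : ℝ) ≠ 0 := by positivity
  have hcard : ∑ _i ∈ Finset.Icc 1 k, 1 / (k : ℝ) = 1 := by
    rw [Finset.sum_const, Nat.card_Icc, Nat.add_sub_cancel, nsmul_eq_mul, mul_one_div_cancel hk0]
  have h1 := (qform_convexOn hA).map_sum_le (t := Finset.Icc 1 k)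
    (w := fun _ => 1 / (k : ℝ))
    (p := fun i => (xs, ys) - (P.onePDHG (1 / q ^ 2) (1 / p ^ 2))^[i] z)
    (fun i _ => by positivity) hcard (fun i _ => Set.mem_univ _)
  have h2 : ∑ i ∈ Finset.Icc 1 k, (1 / (k : ℝ)) •
      ((xs, ys) - (P.onePDHG (1 / q ^ 2) (1 / p ^ 2))^[i] z) =
      (xs, ys) - P.avgPDHG (1 / q ^ 2) (1 / p ^ 2) z k := by
    simp only [smul_sub, Finset.sum_sub_distrib]
    rw [← Finset.sum_smul, hcard, one_smul, avgPDHG, Finset.smul_sum]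
  rw [h2] at h1
  refine h1.trans ?_
  calc _ ≤ ∑ _i ∈ Finset.Icc 1 k, 1 / (k : ℝ) * P.qform q p ((xs, ys) - z) :=
        Finset.sum_le_sum fun i _ =>
          mul_le_mul_of_nonneg_left (qform_iterate_le hq hp hA hst z i) (by positivity)
    _ = _ := by rw [← Finset.sum_mul, hcard, one_mul]

end Saddle

end StdLP

namespace StdLP

variable {m n : ℕ} {P : StdLP m n} {q p : ℝ}

/-! ### Gap bounds -/

/-- The gap of `z` against every test point `ẑ` with `x̂ ≥ 0` is at most `ρ` times the larger of `r`
and twice the weighted distance of `ẑ` from `z`; twice the weighted norm dominates `‖·‖_M`. As the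
gap is affine in the test point, the normalized gap `ρ(r; z)` with `r > 0` has this property. -/
def GapBound (P : StdLP m n) (q p : ℝ) (z : (Fin n → ℝ) × (Fin m → ℝ)) (ρ r : ℝ) : Prop :=
  ∀ z' : (Fin n → ℝ) × (Fin m → ℝ), (∀ i, 0 ≤ z'.1 i) →
    P.gapAt z z' ≤ ρ * max r (2 * wnorm q p (z' - z))

/-- The normalized gap of an average of `k` iterates, at the radius used in the restart condition,
is a gap bound and decays like `1 / k`. If the radius is `0`, then the average is a saddle
point. -/
theorem gapBound_avgPDHG (hq : 0 < q) (hp : 0 < p)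
    (hA : ∀ x, euclidNorm (P.A *ᵥ x) ≤ q * p / 2 * euclidNorm x)
    (z : (Fin n → ℝ) × (Fin m → ℝ)) {k : ℕ} (hk : 1 ≤ k) {w : (Fin n → ℝ) × (Fin m → ℝ)}
    (hw : w = P.avgPDHG (1 / q ^ 2) (1 / p ^ 2) z k) {r ρ : ℝ}
    (hr : r = P.normM (1 / q ^ 2) (1 / p ^ 2) (w - z))
    (hρ : ρ = P.normalizedGap (1 / q ^ 2) (1 / p ^ 2) r w) :
    0 ≤ ρ ∧ ρ ≤ 12 * r / k ∧ P.GapBound q p w ρ r := by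
  have hk0 : (0 : ℝ) < k := by exact_mod_cast hk
  have hw0 : ∀ i, 0 ≤ w.1 i := fun i => by rw [hw]; exact avgPDHG_fst_nonneg _ _ z k i
  have hr0 : 0 ≤ r := by rw [hr]; exact Real.sqrt_nonneg _
  have hwz := wnorm_le_two_mul_normM hA (w - z)
  rw [← hr] at hwz
  have hgap : ∀ z', (∀ i, 0 ≤ z'.1 i) → k * P.gapAt w z' ≤ 3 / 4 * wnorm q p (z' - z) ^ 2 := by
    intro z' hz'
    have h1 := gapAt_avgPDHG_le hq hp hA z z' hz' hk
    rw [← hw] at h1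
    have h2 := qform_le hA (z' - z)
    linarith
  rcases hr0.eq_or_lt with h0 | hrpos
  · have hρ0 : ρ = 0 := by rw [hρ, ← h0, normalizedGap]; simp
    have hzw : w = z := sub_eq_zero.1 (eq_zero_of_wnorm_eq_zero hq hp
      (le_antisymm (by rw [← h0] at hwz; simpa using hwz) (wnorm_nonneg _)))
    refine ⟨hρ0.ge, by rw [hρ0, ← h0]; simp, fun z' hz' => ?_⟩
    rw [hρ0, zero_mul]
    by_contra! hpos
    -- the gap is linear and its bound quadratic in the step towards `z'`
    set C := 3 / 4 * wnorm q p (z' - z) ^ 2 with hC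
    have hC0 : 0 ≤ C := by positivity
    have key : ∀ t : ℝ, 0 < t → t ≤ 1 → k * P.gapAt w z' ≤ t * C := by
      intro t ht ht1
      have h1 := hgap (w + t • (z' - w)) fun i => by
        have e1 := hw0 i
        have e2 := hz' i
        simp only [Prod.fst_add, Prod.smul_fst, Prod.fst_sub, Pi.add_apply, Pi.smul_apply,
          Pi.sub_apply, smul_eq_mul]
        nlinarith
      rw [gapAt_lineMap, hzw, add_sub_cancel_left, wnorm_smul, mul_pow, sq_abs] at h1
      rw [hzw]
      refine le_of_mul_le_mul_left ?_ ht
      calc t * (k * P.gapAt z z') = k * (t * P.gapAt z z') := by ring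
        _ ≤ _ := h1
        _ = t * (t * C) := by rw [hC]; ring
    have hkg : 0 < k * P.gapAt w z' := mul_pos hk0 hpos
    have h1 := key 1 one_pos le_rfl
    have h2 := key (k * P.gapAt w z' / (2 * C)) (by apply div_pos hkg; linarith)
      (by rw [div_le_one (by linarith)]; linarith)
    have h3 : k * P.gapAt w z' / (2 * C) * C = k * P.gapAt w z' / 2 := by
      have : C ≠ 0 := by linarith
      field_simp
    linarith
  · set S := {g | ∃ z' : (Fin n → ℝ) × (Fin m → ℝ), (∀ i, 0 ≤ z'.1 i) ∧
      P.normM (1 / q ^ 2) (1 / p ^ 2) (z' - w) ≤ r ∧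
      g = P.lagrangian w.1 z'.2 - P.lagrangian z'.1 w.2} with hS
    have hρS : ρ = 1 / r * sSup S := hρ
    have hmem0 : (0 : ℝ) ∈ S := by
      refine ⟨w, hw0, ?_, by ring⟩
      rw [sub_self, normM_eq]
      simpa using hr0
    have hub : ∀ g ∈ S, g ≤ 12 * r ^ 2 / k := by
      rintro g ⟨z', hz', hz'r, rfl⟩
      have h1 := hgap z' hz'
      have h2 := wnorm_le_two_mul_normM hA (z' - w)
      have h3 := wnorm_sub_le_add (q := q) (p := p) z' w z
      have h4 : wnorm q p (z' - z) ≤ 4 * r := by linarith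
      have h5 : wnorm q p (z' - z) ^ 2 ≤ (4 * r) ^ 2 := by
        gcongr
        exact wnorm_nonneg _
      rw [le_div_iff₀ hk0, mul_comm]
      change k * P.gapAt w z' ≤ _
      linarith
    have hle : ∀ g ∈ S, g ≤ r * ρ := fun g hg => by
      rw [hρS, ← mul_assoc, mul_one_div_cancel hrpos.ne', one_mul]
      exact le_csSup ⟨_, hub⟩ hg
    have hρ0 : 0 ≤ ρ := by
      have := hle 0 hmem0
      by_contra! h
      nlinarith
    refine ⟨hρ0, ?_, fun z' hz' => ?_⟩
    · rw [hρS, one_div, inv_mul_le_iff₀ hrpos]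
      refine (csSup_le ⟨0, hmem0⟩ hub).trans (le_of_eq ?_)
      ring
    -- a test point outside the ball is moved towards `w` until it lies inside
    · set R := max r (2 * wnorm q p (z' - w)) with hR
      have hRr : r ≤ R := le_max_left _ _
      have hRw : 2 * wnorm q p (z' - w) ≤ R := le_max_right _ _
      have hRpos : 0 < R := hrpos.trans_le hRr
      have ht : 0 < r / R := div_pos hrpos hRpos
      have ht1 : r / R ≤ 1 := (div_le_one hRpos).2 hRr
      have h1 := hle (P.gapAt w (w + (r / R) • (z' - w))) ⟨w + (r / R) • (z' - w), fun i => by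
        have e1 := hw0 i
        have e2 := hz' i
        simp only [Prod.fst_add, Prod.smul_fst, Prod.fst_sub, Pi.add_apply, Pi.smul_apply,
          Pi.sub_apply, smul_eq_mul]
        nlinarith, by
        rw [add_sub_cancel_left, normM_smul, abs_of_pos ht]
        have h2 := (normM_le_two_mul hA (z' - w)).trans hRw
        calc r / R * _ ≤ r / R * R := mul_le_mul_of_nonneg_left h2 ht.le
          _ = r := div_mul_cancel₀ _ hRpos.ne', rfl⟩
      rw [gapAt_lineMap] at h1
      have h3 : r * P.gapAt w z' ≤ r * (ρ * R) := by
        calc r * P.gapAt w z' = R * (r / R * P.gapAt w z') := by field_simp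
          _ ≤ R * (r * ρ) := mul_le_mul_of_nonneg_left h1 hRpos.le
          _ = r * (ρ * R) := by ring
      exact le_of_mul_le_mul_left h3 hrpos

/-- A gap bound controls the slope of the gap in every direction along which a step of length at
least `r` is feasible. -/
theorem GapBound.slope_le {z d : (Fin n → ℝ) × (Fin m → ℝ)} {ρ r T : ℝ}
    (h : P.GapBound q p z ρ r) (hT : 0 < T) (hr : r ≤ 2 * (T * wnorm q p d))
    (hd : ∀ i, 0 ≤ z.1 i + T * d.1 i) :
    (P.b - P.A *ᵥ z.1) ⬝ᵥ d.2 - (P.c - P.Aᵀ *ᵥ z.2) ⬝ᵥ d.1 ≤ 2 * ρ * wnorm q p d := by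
  have h1 := h (z + T • d) fun i => by simpa using hd i
  rw [gapAt_add_smul, add_sub_cancel_left, wnorm_smul, abs_of_pos hT, max_eq_right hr] at h1
  refine le_of_mul_le_mul_left ?_ hT
  linarith

/-- In directions that keep `x` nonnegative the step can be taken long, so the radius is
irrelevant. -/
theorem GapBound.slope_le_of_nonneg {z d : (Fin n → ℝ) × (Fin m → ℝ)} {ρ r : ℝ}
    (h : P.GapBound q p z ρ r) (hz : ∀ i, 0 ≤ z.1 i) (hd : ∀ i, 0 ≤ d.1 i)
    (hd0 : 0 < wnorm q p d) :
    (P.b - P.A *ᵥ z.1) ⬝ᵥ d.2 - (P.c - P.Aᵀ *ᵥ z.2) ⬝ᵥ d.1 ≤ 2 * ρ * wnorm q p d := by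
  refine h.slope_le (T := max 1 (r / (2 * wnorm q p d))) (lt_max_of_lt_left one_pos) ?_ fun i =>
    add_nonneg (hz i) (mul_nonneg (le_max_of_le_left zero_le_one) (hd i))
  have h1 := le_max_right 1 (r / (2 * wnorm q p d))
  rw [div_le_iff₀ (by positivity)] at h1
  linarith

theorem GapBound.primal_residual_le (hp : 0 < p) {z : (Fin n → ℝ) × (Fin m → ℝ)}
    {ρ r : ℝ} (h : P.GapBound q p z ρ r) (hρ : 0 ≤ ρ) (hz : ∀ i, 0 ≤ z.1 i) :
    euclidNorm (P.b - P.A *ᵥ z.1) ≤ 2 * p * ρ := by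
  set e := P.b - P.A *ᵥ z.1 with he
  rcases (euclidNorm_nonneg e).eq_or_lt with h0 | h0
  · rw [← h0]; positivity
  have hw : wnorm q p ((0 : Fin n → ℝ), e) = p * euclidNorm e := by
    rw [← sq_eq_sq₀ (wnorm_nonneg _) (by positivity), wnorm_sq]
    simp [mul_pow, euclidNorm_eq_zero.2 rfl]
  have h1 := h.slope_le_of_nonneg (d := (0, e)) hz (fun i => le_rfl) (by rw [hw]; positivity)
  rw [hw] at h1
  simp only [dotProduct_zero, sub_zero] at h1
  rw [← he, ← euclidNorm_sq] at h1
  nlinarith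

theorem GapBound.slack_residual_le (hq : 0 < q) {z : (Fin n → ℝ) × (Fin m → ℝ)}
    {ρ r : ℝ} (h : P.GapBound q p z ρ r) (hρ : 0 ≤ ρ) (hz : ∀ i, 0 ≤ z.1 i) (i : Fin n) :
    -(2 * q * ρ) ≤ (P.c - P.Aᵀ *ᵥ z.2) i := by
  set s := P.c - P.Aᵀ *ᵥ z.2 with hs
  set d : Fin n → ℝ := fun i => max (-(s i)) 0 with hd
  have hds : s ⬝ᵥ d = -euclidNorm d ^ 2 := by
    rw [euclidNorm_sq, dotProduct, dotProduct, ← Finset.sum_neg_distrib]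
    refine Finset.sum_congr rfl fun j _ => ?_
    simp only [hd]
    rcases le_total (-(s j)) 0 with h1 | h1
    · rw [max_eq_right h1]; simp
    · rw [max_eq_left h1]; ring
  have hdn : euclidNorm d ≤ 2 * q * ρ := by
    rcases (euclidNorm_nonneg d).eq_or_lt with h0 | h0
    · rw [← h0]; positivity
    have hw : wnorm q p (d, (0 : Fin m → ℝ)) = q * euclidNorm d := by
      rw [← sq_eq_sq₀ (wnorm_nonneg _) (by positivity), wnorm_sq]
      simp [mul_pow, euclidNorm_eq_zero.2 rfl]
    have h1 := h.slope_le_of_nonneg (d := (d, 0)) hz (fun i => le_max_right _ _)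
      (by rw [hw]; positivity)
    rw [hw, ← hs, hds] at h1
    simp only [dotProduct_zero] at h1
    nlinarith
  have h2 := (le_abs_self _).trans ((abs_le_euclidNorm d i).trans hdn)
  have h3 : -(s i) ≤ d i := le_max_left _ _
  linarith

end StdLP

namespace StdLP

variable {m n : ℕ} {P : StdLP m n} {q p l : ℝ}

/-! ### Global sharpness of the normalized gap -/

section Condition

variable {xs : Fin n → ℝ} {ys : Fin m → ℝ} {ss : Fin n → ℝ}

theorem IsStrictPair.slack_pos (h : P.IsStrictPair xs ys ss) {j : Fin n}
    (hj : j ∉ posSupport xs) : 0 < ss j := by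
  rw [mem_posSupport] at hj
  rcases h.compl j with h | h
  · exact absurd h.1 hj
  · exact h.2

theorem IsStrictPair.slack_eq_zero (h : P.IsStrictPair xs ys ss) {i : Fin n}
    (hi : i ∈ posSupport xs) : ss i = 0 := by
  rw [mem_posSupport] at hi
  rcases h.compl i with h | h
  · exact h.2
  · rw [h.1] at hi; exact absurd hi (lt_irrefl _)

theorem IsStrictPair.fst_eq_zero (h : P.IsStrictPair xs ys ss) {j : Fin n}
    (hj : j ∉ posSupport xs) : xs j = 0 := by
  rw [mem_posSupport] at hj
  exact le_antisymm (not_lt.1 hj) (h.fst_nonneg j)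

/-- The second factor of `Φ` bounds the lengths of the edge directions at the optimum relative to
the optimal components. -/
theorem exists_Phi_eq (hst : P.IsStrictPair xs ys ss) :
    ∃ G : ℝ, 0 ≤ G ∧ P.Phi xs ss = ((∑ i, |xs i|) + ∑ i, |ss i|) * G ∧
      (∀ j : {j : Fin n // j ∉ posSupport xs},
        √(euclidNorm (fun i => P.tableau (posSupport xs) i j) ^ 2 + 1) ≤ G * ss j) ∧
      ∀ i : posSupport xs,
        √(euclidNorm (fun j => P.tableau (posSupport xs) i j) ^ 2 + 1) ≤ G * xs i := by
  refine ⟨_, ?_, rfl, fun j => ?_, fun i => ?_⟩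
  · exact le_max_of_le_left (Real.iSup_nonneg fun j =>
      div_nonneg (Real.sqrt_nonneg _) (hst.slack_nonneg j))
  · rw [← div_le_iff₀ (hst.slack_pos j.2)]
    refine le_max_of_le_left (le_ciSup (f := fun j : {j : Fin n // j ∉ posSupport xs} =>
      √(euclidNorm (fun i => P.tableau (posSupport xs) i j) ^ 2 + 1) / ss j)
      (Set.finite_range _).bddAbove j)
  · rw [← div_le_iff₀ (mem_posSupport.1 i.2)]
    refine le_max_of_le_right (le_ciSup (f := fun i : posSupport xs =>
      √(euclidNorm (fun j => P.tableau (posSupport xs) i j) ^ 2 + 1) / xs i)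
      (Set.finite_range _).bddAbove i)

theorem one_le_sqrt_sq_add_one (a : ℝ) : 1 ≤ √(a ^ 2 + 1) :=
  Real.one_le_sqrt.2 (by nlinarith [sq_nonneg a])

theorem sum_abs_add_sum_abs (hst : P.IsStrictPair xs ys ss) :
    (∑ i, |xs i|) + ∑ i, |ss i| = ∑ i, (xs i + ss i) := by
  rw [← Finset.sum_add_distrib]
  exact Finset.sum_congr rfl fun i _ => by
    rw [abs_of_nonneg (hst.fst_nonneg i), abs_of_nonneg (hst.slack_nonneg i)]

theorem one_le_mul_add (hst : P.IsStrictPair xs ys ss) {G : ℝ}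
    (h1 : ∀ j : {j : Fin n // j ∉ posSupport xs},
      √(euclidNorm (fun i => P.tableau (posSupport xs) i j) ^ 2 + 1) ≤ G * ss j)
    (h2 : ∀ i : posSupport xs,
      √(euclidNorm (fun j => P.tableau (posSupport xs) i j) ^ 2 + 1) ≤ G * xs i) (i : Fin n) :
    1 ≤ G * (xs i + ss i) := by
  by_cases hi : i ∈ posSupport xs
  · rw [hst.slack_eq_zero hi, add_zero]
    exact (one_le_sqrt_sq_add_one _).trans (h2 ⟨i, hi⟩)
  · rw [hst.fst_eq_zero hi, zero_add]
    exact (one_le_sqrt_sq_add_one _).trans (h1 ⟨i, hi⟩)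

/-- `Φ` is at least the number of variables, since a sum of `n` terms is at least `n` times the
smallest one. -/
theorem two_le_Phi (hn : 2 ≤ n) (hst : P.IsStrictPair xs ys ss) : 2 ≤ P.Phi xs ss := by
  obtain ⟨G, hG, hΦ, h1, h2⟩ := exists_Phi_eq hst
  rw [hΦ, sum_abs_add_sum_abs hst, Finset.sum_mul]
  calc (2 : ℝ) ≤ n := by exact_mod_cast hn
    _ = ∑ _i : Fin n, (1 : ℝ) := by simp
    _ ≤ _ := Finset.sum_le_sum fun i _ => by
        rw [mul_comm]; exact one_le_mul_add hst h1 h2 i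

theorem sum_le_Phi_mul_xi (hn : 2 ≤ n) (hst : P.IsStrictPair xs ys ss) :
    (∑ i, |xs i|) + ∑ i, |ss i| ≤ P.Phi xs ss * xi xs ss := by
  obtain ⟨G, hG, hΦ, h1, h2⟩ := exists_Phi_eq hst
  have : Nonempty (Fin n) := ⟨⟨0, by omega⟩⟩
  obtain ⟨i, hi⟩ := exists_eq_ciInf_of_finite (f := fun i => xs i + ss i)
  rw [xi, ← hi, hΦ, mul_assoc]
  exact le_mul_of_one_le_right (by positivity) (one_le_mul_add hst h1 h2 i)

theorem xi_le (i : Fin n) : xi xs ss ≤ xs i + ss i :=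
  ciInf_le (Set.finite_range _).bddBelow i

theorem xi_pos (hn : 2 ≤ n) (hst : P.IsStrictPair xs ys ss) : 0 < xi xs ss := by
  have : Nonempty (Fin n) := ⟨⟨0, by omega⟩⟩
  obtain ⟨i, hi⟩ := exists_eq_ciInf_of_finite (f := fun i => xs i + ss i)
  rw [xi, ← hi]
  rcases hst.compl i with h | h
  · rw [h.2, add_zero]; exact h.1
  · rw [h.1, zero_add]; exact h.2

/-- As `c` is orthogonal to the row space, `Aᵀ ys` is the projection of `-ss` to the row space. -/
theorem euclidNorm_transpose_mulVec_dual_le (hst : P.IsStrictPair xs ys ss)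
    (hAc : P.A *ᵥ P.c = 0) : euclidNorm (P.Aᵀ *ᵥ ys) ≤ euclidNorm ss := by
  have h1 : P.c ⬝ᵥ (P.Aᵀ *ᵥ ys) = 0 := by rw [dotProduct_mulVec_transpose, hAc, zero_dotProduct]
  refine le_of_sq_le_sq ?_ (euclidNorm_nonneg _)
  have h2 : 0 ≤ P.c ⬝ᵥ P.c := by rw [← euclidNorm_sq]; positivity
  rw [euclidNorm_sq, euclidNorm_sq, ← hst.dual_eq]
  simp only [sub_dotProduct, dotProduct_sub, h1, dotProduct_comm (P.Aᵀ *ᵥ ys) P.c]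
  linarith

theorem wnorm_le_mul_add (hq : 0 < q) (hl : 0 < l)
    (hAl : ∀ y, l * euclidNorm y ≤ euclidNorm (P.Aᵀ *ᵥ y))
    (z : (Fin n → ℝ) × (Fin m → ℝ)) :
    wnorm q (q * l) z ≤ q * (euclidNorm z.1 + euclidNorm (P.Aᵀ *ᵥ z.2)) := by
  have h1 := euclidNorm_nonneg z.1
  have h2 := euclidNorm_nonneg (P.Aᵀ *ᵥ z.2)
  have h3 := euclidNorm_nonneg z.2
  refine le_of_sq_le_sq ?_ (by positivity)
  have h4 : (l * euclidNorm z.2) ^ 2 ≤ euclidNorm (P.Aᵀ *ᵥ z.2) ^ 2 := by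
    gcongr; exact hAl _
  rw [wnorm_sq]
  calc q ^ 2 * euclidNorm z.1 ^ 2 + (q * l) ^ 2 * euclidNorm z.2 ^ 2
      = q ^ 2 * (euclidNorm z.1 ^ 2 + (l * euclidNorm z.2) ^ 2) := by ring
    _ ≤ q ^ 2 * (euclidNorm z.1 + euclidNorm (P.Aᵀ *ᵥ z.2)) ^ 2 := by
        gcongr
        nlinarith [mul_nonneg h1 h2]
    _ = _ := by ring

theorem wnorm_saddle_le (hq : 0 < q) (hl : 0 < l)
    (hAl : ∀ y, l * euclidNorm y ≤ euclidNorm (P.Aᵀ *ᵥ y))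
    (hst : P.IsStrictPair xs ys ss) (hAc : P.A *ᵥ P.c = 0) :
    wnorm q (q * l) (xs, ys) ≤ q * ((∑ i, |xs i|) + ∑ i, |ss i|) := by
  refine (wnorm_le_mul_add hq hl hAl _).trans ?_
  have h1 := euclidNorm_le_sum_abs xs
  have h2 := (euclidNorm_transpose_mulVec_dual_le hst hAc).trans (euclidNorm_le_sum_abs ss)
  gcongr

theorem exists_mulVec_transpose_eq (hl : 0 < l)
    (hAl : ∀ y, l * euclidNorm y ≤ euclidNorm (P.Aᵀ *ᵥ y)) (e : Fin m → ℝ) :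
    ∃ u, P.A *ᵥ (P.Aᵀ *ᵥ u) = e ∧ l * euclidNorm (P.Aᵀ *ᵥ u) ≤ euclidNorm e := by
  have hsq : ∀ u, euclidNorm (P.Aᵀ *ᵥ u) ^ 2 = (P.A *ᵥ (P.Aᵀ *ᵥ u)) ⬝ᵥ u := fun u => by
    rw [euclidNorm_sq, dotProduct_mulVec_transpose]
  let φ : (Fin m → ℝ) →ₗ[ℝ] (Fin m → ℝ) := P.A.mulVecLin ∘ₗ P.Aᵀ.mulVecLin
  have hinj : Function.Injective φ := by
    rw [injective_iff_map_eq_zero]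
    intro u hu
    have h1 := hsq u
    rw [show P.A *ᵥ (P.Aᵀ *ᵥ u) = 0 from hu, zero_dotProduct, sq_eq_zero_iff] at h1
    have h2 := hAl u
    rw [h1] at h2
    exact euclidNorm_eq_zero.1 (le_antisymm (by nlinarith) (euclidNorm_nonneg u))
  obtain ⟨u, hu⟩ := LinearMap.injective_iff_surjective.1 hinj e
  have hu' : P.A *ᵥ (P.Aᵀ *ᵥ u) = e := hu
  refine ⟨u, hu', ?_⟩
  have h1 := hsq u
  rw [hu'] at h1
  have h2 := dotProduct_le_euclidNorm_mul e u
  have h3 := hAl u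
  have h4 := euclidNorm_nonneg e
  rcases (euclidNorm_nonneg (P.Aᵀ *ᵥ u)).eq_or_lt with h0 | h0
  · rw [← h0, mul_zero]; exact h4
  · refine le_of_mul_le_mul_right ?_ h0
    nlinarith [mul_le_mul_of_nonneg_left h3 h4]

/-- For primal and dual feasible points the gap `cᵀx - bᵀy` is `ssᵀx + xsᵀs`. -/
theorem gap_eq_of_feasible (hst : P.IsStrictPair xs ys ss) {x : Fin n → ℝ}
    (hx : P.A *ᵥ x = P.b) (y : Fin m → ℝ) :
    ss ⬝ᵥ x + xs ⬝ᵥ (P.c - P.Aᵀ *ᵥ y) = P.c ⬝ᵥ x - P.b ⬝ᵥ y := by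
  have h0 : xs ⬝ᵥ ss = 0 := Finset.sum_eq_zero fun i _ => by
    rcases hst.compl i with h | h
    · rw [h.2, mul_zero]
    · rw [h.1, zero_mul]
  have h1 : P.c ⬝ᵥ x = P.b ⬝ᵥ ys + ss ⬝ᵥ x := by
    rw [← hst.dual, add_dotProduct, dotProduct_comm, dotProduct_mulVec_transpose, hx]
  have h2 : xs ⬝ᵥ P.c = P.b ⬝ᵥ ys := by
    rw [← hst.dual, dotProduct_add, dotProduct_mulVec_transpose, hst.primal, h0, add_zero]
  rw [dotProduct_sub, dotProduct_mulVec_transpose, hst.primal, h1, h2]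
  ring

theorem sum_abs_mul_le {ι : Type*} [Fintype ι] (a v : ι → ℝ) (hv : ∀ i, 0 ≤ v i) {δ : ℝ}
    (ha : ∀ i, -δ ≤ a i) (hδ : 0 ≤ δ) : ∑ i, |a i| * v i ≤ v ⬝ᵥ a + 2 * δ * ∑ i, |v i| := by
  rw [dotProduct, Finset.mul_sum, ← Finset.sum_add_distrib]
  refine Finset.sum_le_sum fun i _ => ?_
  have h1 : |a i| ≤ a i + 2 * δ := abs_le.2 ⟨by linarith [ha i], by linarith⟩
  rw [abs_of_nonneg (hv i)]
  nlinarith [mul_le_mul_of_nonneg_right h1 (hv i)]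

/-- A gap bound controls the primal residual, the negative part of the slack and, through the test
point `0`, the gap `cᵀx - bᵀy`. A point of the affine space of feasible equations is determined by
the components `x_N` and `s_B`, which the gap weights by `s⋆` and `x⋆`; the edge lengths relative
to these weights are what `Φ` measures. -/
theorem GapBound.dist_le (hn : 2 ≤ n) (hq : 0 < q) (hl : 0 < l)
    (hAl : ∀ y, l * euclidNorm y ≤ euclidNorm (P.Aᵀ *ᵥ y))
    (hst : P.IsStrictPair xs ys ss) (hB : (P.basisMap (posSupport xs)).IsInvertible)
    (hAc : P.A *ᵥ P.c = 0) {z : (Fin n → ℝ) × (Fin m → ℝ)} {ρ r : ℝ}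
    (h : P.GapBound q (q * l) z ρ r) (hρ : 0 ≤ ρ) (hz : ∀ i, 0 ≤ z.1 i)
    (hr : r ≤ 12 * wnorm q (q * l) (xs, ys))
    (hzn : wnorm q (q * l) z ≤ 3 * wnorm q (q * l) (xs, ys)) :
    euclidNorm (z.1 - xs) + euclidNorm (P.Aᵀ *ᵥ (z.2 - ys)) ≤ 17 * P.Phi xs ss * (q * ρ) := by
  have hD := wnorm_saddle_le hq hl hAl hst hAc
  have hΦ2 := two_le_Phi hn hst
  obtain ⟨G, hG, hΦ, hGs, hGx⟩ := exists_Phi_eq hst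
  set D := (∑ i, |xs i|) + ∑ i, |ss i| with hDdef
  have hD0 : 0 ≤ D := by positivity
  set K := q * ρ with hK
  have hK0 : 0 ≤ K := by positivity
  have hp : 0 < q * l := by positivity
  have hν0 := wnorm_nonneg (q := q) (p := q * l) (xs, ys)
  -- the gap against the origin
  have hgap : P.c ⬝ᵥ z.1 - P.b ⬝ᵥ z.2 ≤ 12 * D * K := by
    have h1 := h (0, 0) (fun i => le_rfl)
    have h2 : P.gapAt z (0, 0) = P.c ⬝ᵥ z.1 - P.b ⬝ᵥ z.2 := by
      simp [gapAt, lagrangian]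
    have h3 : wnorm q (q * l) ((0, 0) - z) = wnorm q (q * l) z := by
      rw [show ((0, 0) : (Fin n → ℝ) × (Fin m → ℝ)) = 0 from rfl, zero_sub, wnorm_neg]
    rw [h2, h3] at h1
    refine h1.trans ?_
    calc ρ * max r (2 * wnorm q (q * l) z) ≤ ρ * (12 * (q * D)) := by
          refine mul_le_mul_of_nonneg_left (max_le ?_ ?_) hρ <;> linarith
      _ = 12 * D * K := by rw [hK]; ring
  -- projection of `x` to the affine space `A x = b`
  obtain ⟨u, hu, hun⟩ := exists_mulVec_transpose_eq hl hAl (P.b - P.A *ᵥ z.1)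
  have he := h.primal_residual_le hp hρ hz
  have hun2 : euclidNorm (P.Aᵀ *ᵥ u) ≤ 2 * K := by
    refine le_of_mul_le_mul_left ?_ hl
    calc _ ≤ _ := hun
      _ ≤ _ := he
      _ = l * (2 * K) := by rw [hK]; ring
  set x' := z.1 + P.Aᵀ *ᵥ u with hx'
  have hAx' : P.A *ᵥ x' = P.b := by rw [hx', Matrix.mulVec_add, hu]; abel
  have hcx' : P.c ⬝ᵥ x' = P.c ⬝ᵥ z.1 := by
    rw [hx', dotProduct_add, dotProduct_mulVec_transpose, hAc, zero_dotProduct, add_zero]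
  have hx'low : ∀ j, -(2 * K) ≤ x' j := fun j => by
    have h1 := (abs_le.1 ((abs_le_euclidNorm (P.Aᵀ *ᵥ u) j).trans hun2)).1
    have h2 := hz j
    rw [hx', Pi.add_apply]; linarith
  set s := P.c - P.Aᵀ *ᵥ z.2 with hs
  have hslow : ∀ i, -(2 * K) ≤ s i := fun i => by
    have := h.slack_residual_le hq hρ hz i
    rw [← hs] at this
    rw [hK]; linarith
  have hsub : s = ss + P.Aᵀ *ᵥ (ys - z.2) := by
    rw [hs, ← hst.dual, Matrix.mulVec_sub]; abel
  have hsum : ∑ j, |x' j| * ss j + ∑ i, |s i| * xs i ≤ 16 * D * K := by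
    have h1 := sum_abs_mul_le x' ss hst.slack_nonneg hx'low (by positivity)
    have h2 := sum_abs_mul_le s xs hst.fst_nonneg hslow (by positivity)
    have h3 := gap_eq_of_feasible hst hAx' z.2
    rw [hcx', ← hs] at h3
    have h4 : 2 * (2 * K) * ∑ i, |ss i| + 2 * (2 * K) * ∑ i, |xs i| = 4 * D * K := by
      rw [hDdef]; ring
    linarith
  have hdx : euclidNorm (x' - xs) ≤ G * ∑ j, |x' j| * ss j := by
    refine (euclidNorm_le_sum_nonbasic hB
      (by rw [Matrix.mulVec_sub, hAx', hst.primal, sub_self])).trans ?_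
    rw [sum_eq_sum_subtype (posSupport xs), Finset.sum_eq_zero
      (f := fun i : posSupport xs => |x' i| * ss i) fun i _ => by
      rw [hst.slack_eq_zero i.2, mul_zero], zero_add, Finset.mul_sum]
    refine Finset.sum_le_sum fun j _ => ?_
    rw [Pi.sub_apply, hst.fst_eq_zero j.2, sub_zero, mul_left_comm]
    exact mul_le_mul_of_nonneg_left (hGs j) (abs_nonneg _)
  have hds : euclidNorm (P.Aᵀ *ᵥ (ys - z.2)) ≤ G * ∑ i, |s i| * xs i := by
    refine (euclidNorm_le_sum_basic hB _).trans ?_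
    rw [sum_eq_sum_subtype (posSupport xs), Finset.sum_eq_zero
      (f := fun j : {j : Fin n // j ∉ posSupport xs} => |s j| * xs j) fun j _ => by
      rw [hst.fst_eq_zero j.2, mul_zero], add_zero, Finset.mul_sum]
    refine Finset.sum_le_sum fun i _ => ?_
    rw [hsub, Pi.add_apply, hst.slack_eq_zero i.2, zero_add, mul_left_comm]
    exact mul_le_mul_of_nonneg_left (hGx i) (abs_nonneg _)
  have hzx : euclidNorm (z.1 - xs) ≤ euclidNorm (x' - xs) + euclidNorm (P.Aᵀ *ᵥ u) := by
    rw [show z.1 - xs = (x' - xs) - P.Aᵀ *ᵥ u by rw [hx']; abel]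
    exact euclidNorm_sub_le _ _
  have hneg : euclidNorm (P.Aᵀ *ᵥ (z.2 - ys)) = euclidNorm (P.Aᵀ *ᵥ (ys - z.2)) := by
    rw [← neg_sub, Matrix.mulVec_neg, euclidNorm_neg]
  have h5 := mul_le_mul_of_nonneg_left hsum hG
  have h6 : G * (16 * D * K) = 16 * P.Phi xs ss * K := by rw [hΦ]; ring
  have h7 : 2 * K ≤ P.Phi xs ss * K := mul_le_mul_of_nonneg_right hΦ2 hK0
  rw [hneg]
  linarith

/-! ### Local sharpness and identification of the basis -/

/-- On the face `x_N = 0` near the optimum the test directions `(-s_B, b - A x)` are feasible, so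
the gap bound controls the residuals of the square systems for `x_B` and `y`. -/
theorem GapBound.local_dist_le (hq : 0 < q) (hp : 0 < p)
    (hst : P.IsStrictPair xs ys ss) (hB : (P.basisMap (posSupport xs)).IsInvertible)
    {z : (Fin n → ℝ) × (Fin m → ℝ)} {ρ r η : ℝ}
    (h : P.GapBound q p z ρ r) (hρ : 0 ≤ ρ) (hη : 0 < η) (hr : r ≤ 4 * η)
    (hN : ∀ j ∉ posSupport xs, z.1 j = 0) (hΘ : ∀ i ∈ posSupport xs, 2 * η ≤ q * z.1 i) :
    wnorm q p (z - (xs, ys)) ≤ 2 * (q * p * ‖P.basisInv (posSupport xs)‖) * ρ := by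
  set Θ := posSupport xs with hΘdef
  set e := P.b - P.A *ᵥ z.1 with he
  set s := P.c - P.Aᵀ *ᵥ z.2 with hs
  set sB : Θ → ℝ := fun i => s i with hsB
  set d : (Fin n → ℝ) × (Fin m → ℝ) :=
    (-((1 / q ^ 2) • extendZero Θ sB), (1 / p ^ 2) • e) with hd
  have hνd : wnorm q p d ^ 2 = euclidNorm sB ^ 2 / q ^ 2 + euclidNorm e ^ 2 / p ^ 2 := by
    rw [wnorm_sq, hd]
    simp only [euclidNorm_neg, euclidNorm_smul, euclidNorm_extendZero, mul_pow, sq_abs]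
    field_simp
  have hslope : e ⬝ᵥ d.2 - s ⬝ᵥ d.1 = wnorm q p d ^ 2 := by
    have h1 : s ⬝ᵥ extendZero Θ sB = euclidNorm sB ^ 2 := by
      rw [dotProduct, sum_eq_sum_subtype Θ, euclidNorm_sq]
      simp [hsB, dotProduct]
    rw [hνd, hd]
    simp only [dotProduct_neg, dotProduct_smul, smul_eq_mul, h1, ← euclidNorm_sq]
    ring
  have hνle : wnorm q p d ≤ 2 * ρ := by
    rcases (wnorm_nonneg (q := q) (p := p) d).eq_or_lt with h0 | h0
    · rw [← h0]; positivity
    have hT : 0 < 2 * η / wnorm q p d := by positivity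
    have h1 := h.slope_le (d := d) hT
      (by rw [div_mul_cancel₀ _ h0.ne']; linarith) fun i => by
        by_cases hi : i ∈ Θ
        · have e1 := hΘ i hi
          have e2 := (mul_le_mul_of_nonneg_left (abs_le_euclidNorm d.1 i) hq.le).trans
            (mul_euclidNorm_fst_le (q := q) (p := p) d)
          have e3 := neg_abs_le (d.1 i)
          have e4 : 2 * η / wnorm q p d * (q * |d.1 i|) ≤ 2 * η := by
            calc _ ≤ 2 * η / wnorm q p d * wnorm q p d := mul_le_mul_of_nonneg_left e2 hT.le
              _ = 2 * η := div_mul_cancel₀ _ h0.ne'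
          have e5 := mul_le_mul_of_nonneg_left e3 hT.le
          refine nonneg_of_mul_nonneg_right ?_ hq
          nlinarith
        · have : d.1 i = 0 := by simp [hd, extendZero_of_notMem sB hi]
          rw [this, hN i hi]; simp
    rw [← he, ← hs, hslope] at h1
    nlinarith
  have hx : euclidNorm (z.1 - xs) ≤ ‖P.basisInv Θ‖ * euclidNorm e := by
    have h1 := euclidNorm_le_basisInv_mul hB (d := z.1 - xs) fun j hj => by
      rw [Pi.sub_apply, hN j hj, hst.fst_eq_zero hj, sub_zero]
    rwa [Matrix.mulVec_sub, hst.primal, ← neg_sub P.b, euclidNorm_neg] at h1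
  have hy : euclidNorm (z.2 - ys) ≤ ‖P.basisInv Θ‖ * euclidNorm sB := by
    have h1 := euclidNorm_le_basisInv_mul_transpose hB (ys - z.2)
    have h2 : (fun i : Θ => (P.Aᵀ *ᵥ (ys - z.2)) i) = sB := by
      ext i
      have h3 := congrFun hst.dual i
      rw [Pi.add_apply, hst.slack_eq_zero i.2, add_zero] at h3
      simp [hsB, hs, Matrix.mulVec_sub, h3]
    rwa [h2, ← neg_sub, euclidNorm_neg] at h1
  set b := ‖P.basisInv Θ‖ with hb
  have hb0 : 0 ≤ b := norm_nonneg _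
  have hz : wnorm q p (z - (xs, ys)) ≤ q * p * b * wnorm q p d := by
    refine le_of_sq_le_sq ?_ (mul_nonneg (by positivity) (wnorm_nonneg _))
    rw [wnorm_sq, mul_pow, hνd]
    have e1 : euclidNorm (z.1 - xs) ^ 2 ≤ (b * euclidNorm e) ^ 2 :=
      pow_le_pow_left₀ (euclidNorm_nonneg _) hx 2
    have e2 : euclidNorm (z.2 - ys) ^ 2 ≤ (b * euclidNorm sB) ^ 2 :=
      pow_le_pow_left₀ (euclidNorm_nonneg _) hy 2
    calc q ^ 2 * euclidNorm (z.1 - xs) ^ 2 + p ^ 2 * euclidNorm (z.2 - ys) ^ 2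
        ≤ q ^ 2 * (b * euclidNorm e) ^ 2 + p ^ 2 * (b * euclidNorm sB) ^ 2 := by gcongr
      _ = _ := by field_simp; ring
  calc _ ≤ _ := hz
    _ ≤ q * p * b * (2 * ρ) := mul_le_mul_of_nonneg_left hνle (by positivity)
    _ = _ := by ring

/-- Near the optimum one step already annihilates the nonbasic components, and the basic components
stay positive; both properties pass to the averages, which do not contain the starting point. -/
theorem avgPDHG_identifies (hq : 0 < q) (hq2 : 2 ≤ q ^ 2) (hp : 0 < p)
    (hA : ∀ x, euclidNorm (P.A *ᵥ x) ≤ q * p / 2 * euclidNorm x)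
    (hst : P.IsStrictPair xs ys ss) {η ξ : ℝ} (hη : 0 < η) (hξ : ∀ i, ξ ≤ xs i + ss i)
    (hηξ : 4 * q * η ≤ ξ) {z : (Fin n → ℝ) × (Fin m → ℝ)}
    (hz : wnorm q p (z - (xs, ys)) ≤ η / 2) {k : ℕ} (hk : 1 ≤ k) :
    (∀ j ∉ posSupport xs, (P.avgPDHG (1 / q ^ 2) (1 / p ^ 2) z k).1 j = 0) ∧
      ∀ i ∈ posSupport xs, 2 * η ≤ q * (P.avgPDHG (1 / q ^ 2) (1 / p ^ 2) z k).1 i := by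
  have hit : ∀ j, wnorm q p ((P.onePDHG (1 / q ^ 2) (1 / p ^ 2))^[j] z - (xs, ys)) ≤ η := by
    intro j
    have h1 := wnorm_le_two_mul_of_qform_le hA (qform_iterate_le hq hp hA hst z j)
    rw [wnorm_sub_comm, wnorm_sub_comm _ z] at h1
    linarith
  have hcomp : ∀ w : (Fin n → ℝ) × (Fin m → ℝ), wnorm q p (w - (xs, ys)) ≤ η →
      ∀ i, q * |w.1 i - xs i| ≤ η := by
    intro w hw i
    have h1 := mul_le_mul_of_nonneg_left (abs_le_euclidNorm (w - (xs, ys)).1 i) hq.le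
    exact h1.trans ((mul_euclidNorm_fst_le (q := q) (p := p) _).trans hw)
  refine ⟨fun j hj => ?_, fun i hi => ?_⟩
  · rw [avgPDHG_fst_apply, Finset.sum_eq_zero, mul_zero]
    intro t ht
    obtain ⟨t, rfl⟩ := Nat.exists_eq_add_of_le' (Finset.mem_Icc.1 ht).1
    rw [Function.iterate_succ_apply']
    set w := (P.onePDHG (1 / q ^ 2) (1 / p ^ 2))^[t] z with hw
    have hwη := hit t
    rw [← hw] at hwη
    refine max_eq_right ?_
    have h2 := hcomp w hwη j
    rw [hst.fst_eq_zero hj, sub_zero] at h2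
    have h3 := mul_le_mul_of_nonneg_left (le_abs_self (w.1 j)) hq.le
    have h4 := hξ j
    rw [hst.fst_eq_zero hj, zero_add] at h4
    have h5 : |(P.Aᵀ *ᵥ (w.2 - ys)) j| ≤ q / 2 * η := by
      refine (abs_le_euclidNorm _ j).trans
        ((euclidNorm_transpose_mulVec_le (by positivity) hA _).trans ?_)
      have h6 := (mul_euclidNorm_snd_le (q := q) (p := p) (w - (xs, ys))).trans hwη
      calc q * p / 2 * euclidNorm (w.2 - ys) = q / 2 * (p * euclidNorm (w.2 - ys)) := by ring
        _ ≤ q / 2 * η := mul_le_mul_of_nonneg_left h6 (by positivity)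
    have h6 : (P.c - P.Aᵀ *ᵥ w.2) j = ss j - (P.Aᵀ *ᵥ (w.2 - ys)) j := by
      rw [← hst.dual, Matrix.mulVec_sub]
      simp only [Pi.sub_apply, Pi.add_apply]
      ring
    have h7 := (abs_le.1 h5).2
    have h8 : q * (q * w.1 j) ≤ q * η := mul_le_mul_of_nonneg_left (h3.trans h2) hq.le
    have h9 : 0 < q * η := by positivity
    rw [Pi.sub_apply, Pi.smul_apply, smul_eq_mul, sub_nonpos, one_div, inv_mul_eq_div,
      le_div_iff₀ (by positivity), h6]
    nlinarith
  · have h1 := wnorm_le_two_mul_of_qform_le hA (qform_avgPDHG_le hq hp hA hst z hk)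
    rw [wnorm_sub_comm, wnorm_sub_comm _ z] at h1
    have h2 := hcomp _ (h1.trans (by linarith)) i
    have h3 := hξ i
    rw [hst.slack_eq_zero hi, add_zero] at h3
    have h4 := mul_le_mul_of_nonneg_left
      (neg_abs_le ((P.avgPDHG (1 / q ^ 2) (1 / p ^ 2) z k).1 i - xs i)) hq.le
    have h5 := mul_le_mul_of_nonneg_left (hηξ.trans h3) hq.le
    nlinarith

end Condition

end StdLP

namespace StdLP

variable {m n : ℕ} {P : StdLP m n} {τ σ β q l : ℝ}

/-! ### Convergence of the restarted method -/

/-- The assumptions of the convergence analysis, with the step-sizes written as `τ = 1/q²` and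
`σ = 1/(q l)²`; then `κ = q²/2`, and `l` and `q (q l) / 2` play the roles of the extreme singular
values. -/
structure IsScaled (P : StdLP m n) (τ σ β q l : ℝ) (xs : Fin n → ℝ) (ys : Fin m → ℝ)
    (ss : Fin n → ℝ) : Prop where
  τ_eq : τ = 1 / q ^ 2
  σ_eq : σ = 1 / (q * l) ^ 2
  β_eq : β = 1 / Real.exp 1
  one_le_m : 1 ≤ m
  two_le_n : 2 ≤ n
  q_pos : 0 < q
  two_le_sq : 2 ≤ q ^ 2
  l_pos : 0 < l
  upper : ∀ x, euclidNorm (P.A *ᵥ x) ≤ q * (q * l) / 2 * euclidNorm x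
  lower : ∀ y, l * euclidNorm y ≤ euclidNorm (P.Aᵀ *ᵥ y)
  strict : P.IsStrictPair xs ys ss
  basis : (P.basisMap (posSupport xs)).IsInvertible
  orth : P.A *ᵥ P.c = 0

/-- The normalized gap `ρ(‖z^{N,0} - z^{N-1,0}‖_M; z^{N,0})` of the `N`-th outer iterate. -/
noncomputable def outerGap (P : StdLP m n) (τ σ β : ℝ) (N : ℕ) : ℝ :=
  P.normalizedGap τ σ (P.normM τ σ ((P.outerPair τ σ β N).2 - (P.outerPair τ σ β N).1))
    (P.outerPair τ σ β N).2

/-- The length of the `N`-th inner loop of the run. -/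
noncomputable def innerLength (P : StdLP m n) (τ σ β : ℝ) (N : ℕ) : ℕ :=
  P.loopLength τ σ β N (P.outerPair τ σ β N).1 (P.outerPair τ σ β N).2

theorem outer_succ (τ σ β : ℝ) (N : ℕ) :
    P.outer τ σ β (N + 1) = P.avgPDHG τ σ (P.outer τ σ β N) (P.innerLength τ σ β N) := rfl

theorem totalIter_succ (τ σ β : ℝ) (N : ℕ) :
    P.totalIter τ σ β (N + 1) = P.totalIter τ σ β N + P.innerLength τ σ β N :=
  Finset.sum_range_succ _ _

theorem totalIter_mono (τ σ β : ℝ) : Monotone (P.totalIter τ σ β) :=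
  monotone_nat_of_le_succ fun N => by rw [totalIter_succ]; exact Nat.le_add_right _ _

theorem loopTerminates_zero (τ σ β : ℝ) : P.LoopTerminates τ σ β 0 :=
  ⟨1, le_rfl, Or.inl ⟨rfl, rfl⟩⟩

theorem totalIter_one_le (τ σ β : ℝ) : P.totalIter τ σ β 1 ≤ 1 := by
  rw [totalIter, Finset.sum_range_one]
  exact Nat.sInf_le ⟨le_rfl, Or.inl ⟨rfl, rfl⟩⟩

theorem LoopTerminates.one_le {N : ℕ} (h : P.LoopTerminates τ σ β N) :
    1 ≤ P.innerLength τ σ β N := (Nat.sInf_mem h).1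

theorem LoopTerminates.outerGap_succ_le {N : ℕ}
    (h : P.LoopTerminates τ σ β (N + 1)) :
    P.outerGap τ σ β (N + 2) ≤ β * P.outerGap τ σ β (N + 1) := by
  rcases (Nat.sInf_mem h).2 with h1 | h1
  · exact absurd h1.1 (Nat.succ_ne_zero N)
  · exact h1

section Run

variable {xs : Fin n → ℝ} {ys : Fin m → ℝ} {ss : Fin n → ℝ}

theorem IsScaled.p_pos (h : P.IsScaled τ σ β q l xs ys ss) : 0 < q * l := mul_pos h.q_pos h.l_pos

theorem IsScaled.normM_le (h : P.IsScaled τ σ β q l xs ys ss)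
    (z : (Fin n → ℝ) × (Fin m → ℝ)) : P.normM τ σ z ≤ 2 * wnorm q (q * l) z := by
  rw [h.τ_eq, h.σ_eq]
  exact normM_le_two_mul h.upper z

theorem IsScaled.avgPDHG_spec (h : P.IsScaled τ σ β q l xs ys ss)
    (z : (Fin n → ℝ) × (Fin m → ℝ)) {k : ℕ} (hk : 1 ≤ k) {w : (Fin n → ℝ) × (Fin m → ℝ)}
    (hw : w = P.avgPDHG τ σ z k) {ρ : ℝ}
    (hρ : ρ = P.normalizedGap τ σ (P.normM τ σ (w - z)) w) :
    0 ≤ ρ ∧ ρ ≤ 12 * P.normM τ σ (w - z) / k ∧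
      P.GapBound q (q * l) w ρ (P.normM τ σ (w - z)) ∧
      P.qform q (q * l) ((xs, ys) - w) ≤ P.qform q (q * l) ((xs, ys) - z) := by
  have hτ := h.τ_eq
  have hσ := h.σ_eq
  subst hτ hσ
  obtain ⟨h1, h2, h3⟩ := gapBound_avgPDHG h.q_pos h.p_pos h.upper z hk hw rfl hρ
  refine ⟨h1, h2, h3, ?_⟩
  rw [hw]
  exact qform_avgPDHG_le h.q_pos h.p_pos h.upper h.strict z hk

/-- If the distance to the optimum is at most `α` times the normalized gap, then the loop has
`O(α)` iterations: the gap of the averages is at most `72 / k` times this distance. -/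
theorem IsScaled.innerLength_le (h : P.IsScaled τ σ β q l xs ys ss) {N : ℕ}
    {α : ℝ} (hα : 0 ≤ α)
    (hdist : wnorm q (q * l) (P.outer τ σ β N - (xs, ys)) ≤
      α * P.outerGap τ σ β N)
    (hgap : 0 ≤ P.outerGap τ σ β N) :
    P.LoopTerminates τ σ β N ∧
      (P.innerLength τ σ β N : ℝ) ≤ 216 * α + 1 := by
  set k := ⌊216 * α⌋₊ + 1 with hk
  have hk1 : 1 ≤ k := Nat.le_add_left _ _
  have hkα : 216 * α ≤ k := by
    rw [hk]; push_cast; exact (Nat.lt_floor_add_one _).le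
  have hkα' : (k : ℝ) ≤ 216 * α + 1 := by
    rw [hk]; push_cast
    linarith [Nat.floor_le (show 0 ≤ 216 * α by positivity)]
  have hk0 : (0 : ℝ) < k := by exact_mod_cast hk1
  set z := P.outer τ σ β N with hz
  set ρ := P.outerGap τ σ β N with hρ
  set w := P.avgPDHG τ σ z k with hw
  obtain ⟨-, h2, -, h0⟩ := h.avgPDHG_spec z hk1 hw rfl
  have h3 := wnorm_le_two_mul_of_qform_le h.upper h0
  have h4 := h.normM_le (w - z)
  have h5 := wnorm_sub_le_add (q := q) (p := q * l) w (xs, ys) z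
  rw [wnorm_sub_comm w (xs, ys)] at h5
  rw [wnorm_sub_comm (xs, ys) z] at h3 h5
  have hcond : P.RestartCondition τ σ β N
      (P.outerPair τ σ β N).1
      (P.outerPair τ σ β N).2 k := by
    refine Or.inr (h2.trans ?_)
    change _ ≤ β * ρ
    have he : Real.exp 1 ≤ 3 := by linarith [Real.exp_one_lt_d9]
    have hβ3 : 1 / 3 ≤ β := by
      rw [h.β_eq]; exact one_div_le_one_div_of_le (Real.exp_pos 1) he
    rw [div_le_iff₀ hk0]
    calc 12 * P.normM τ σ (w - z) ≤ 72 * (α * ρ) := by linarith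
      -- `1 / 3 ≤ β` accounts for `216 = 3 * 72`
      _ = 1 / 3 * ρ * (216 * α) := by ring
      _ ≤ β * ρ * k := by gcongr
  have hlen : P.innerLength τ σ β N ≤ k := Nat.sInf_le ⟨hk1, hcond⟩
  exact ⟨⟨k, hk1, hcond⟩, le_trans (by exact_mod_cast hlen) hkα'⟩

/-- What a terminating loop provides for the next outer iterate. -/
theorem IsScaled.outer_succ_spec (h : P.IsScaled τ σ β q l xs ys ss) {N : ℕ}
    (ht : P.LoopTerminates τ σ β N) :
    0 ≤ P.outerGap τ σ β (N + 1) ∧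
    P.outerGap τ σ β (N + 1) ≤
      12 * P.normM τ σ (P.outer τ σ β (N + 1) -
        P.outer τ σ β N) ∧
    P.GapBound q (q * l) (P.outer τ σ β (N + 1))
      (P.outerGap τ σ β (N + 1))
      (P.normM τ σ (P.outer τ σ β (N + 1) -
        P.outer τ σ β N)) ∧
    P.qform q (q * l) ((xs, ys) - P.outer τ σ β (N + 1)) ≤
      P.qform q (q * l) ((xs, ys) - P.outer τ σ β N) := by
  have hk := ht.one_le
  obtain ⟨h1, h2, h3, h4⟩ := h.avgPDHG_spec (P.outer τ σ β N) hk (outer_succ τ σ β N)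
    (ρ := P.outerGap τ σ β (N + 1)) rfl
  refine ⟨h1, h2.trans (div_le_self ?_ (by exact_mod_cast hk)), h3, h4⟩
  exact mul_nonneg (by norm_num) (Real.sqrt_nonneg _)

/-- The bounds for the next outer iterate, as long as the quadratic form has not increased: the
global sharpness of the normalized gap applies, since the iterates stay in a ball of radius
comparable to the norm of the saddle point. -/
theorem IsScaled.outer_succ_bounds (h : P.IsScaled τ σ β q l xs ys ss) {N : ℕ}
    (hN : P.LoopTerminates τ σ β N)
    (hQ : P.qform q (q * l) ((xs, ys) - P.outer τ σ β N) ≤ P.qform q (q * l) (xs, ys)) :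
    P.LoopTerminates τ σ β (N + 1) ∧
    (P.innerLength τ σ β (N + 1) : ℝ) ≤ 216 * (17 * q ^ 2 * P.Phi xs ss) + 1 ∧
    euclidNorm ((P.outer τ σ β (N + 1)).1 - xs) +
      euclidNorm (P.Aᵀ *ᵥ ((P.outer τ σ β (N + 1)).2 - ys)) ≤
        17 * P.Phi xs ss * (q * P.outerGap τ σ β (N + 1)) ∧
    P.outerGap τ σ β (N + 1) ≤ 144 * wnorm q (q * l) (xs, ys) := by
  obtain ⟨hρ0, hρr, hgb, hqf⟩ := h.outer_succ_spec hN
  set z := P.outer τ σ β (N + 1) with hz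
  set z0 := P.outer τ σ β N with hz0
  set ρ := P.outerGap τ σ β (N + 1) with hρ
  set ν := wnorm q (q * l) (xs, ys) with hν
  have e1 : wnorm q (q * l) ((xs, ys) - z) ≤ 2 * ν :=
    wnorm_le_two_mul_of_qform_le h.upper (hqf.trans hQ)
  have e2 : wnorm q (q * l) ((xs, ys) - z0) ≤ 2 * ν := wnorm_le_two_mul_of_qform_le h.upper hQ
  have e3 : wnorm q (q * l) z ≤ 3 * ν := by
    have := wnorm_sub_le_add (q := q) (p := q * l) z (xs, ys) 0
    rw [sub_zero, sub_zero, wnorm_sub_comm] at this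
    linarith
  have e4 : P.normM τ σ (z - z0) ≤ 12 * ν := by
    have e5 := h.normM_le (z - z0)
    have e6 := wnorm_sub_le_add (q := q) (p := q * l) z (xs, ys) z0
    rw [wnorm_sub_comm z (xs, ys)] at e6
    have e7 : 0 ≤ ν := wnorm_nonneg _
    linarith
  have hz1 : ∀ i, 0 ≤ z.1 i := fun i => by
    rw [hz, outer_succ]; exact avgPDHG_fst_nonneg _ _ _ _ i
  have hd := hgb.dist_le h.two_le_n h.q_pos h.l_pos h.lower h.strict h.basis h.orth hρ0 hz1
    e4 e3
  have hΦ := two_le_Phi h.two_le_n h.strict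
  have hq := h.q_pos
  have hw : wnorm q (q * l) (z - (xs, ys)) ≤ 17 * q ^ 2 * P.Phi xs ss * ρ := by
    refine (wnorm_le_mul_add h.q_pos h.l_pos h.lower _).trans ?_
    calc q * _ ≤ q * (17 * P.Phi xs ss * (q * ρ)) := mul_le_mul_of_nonneg_left hd hq.le
      _ = _ := by ring
  obtain ⟨ht, hlen⟩ := h.innerLength_le (by positivity) hw hρ0
  exact ⟨ht, hlen, hd, by linarith⟩

theorem IsScaled.loopTerminates_and_qform_le (h : P.IsScaled τ σ β q l xs ys ss) (N : ℕ) :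
    P.LoopTerminates τ σ β N ∧
      P.qform q (q * l) ((xs, ys) - P.outer τ σ β N) ≤ P.qform q (q * l) (xs, ys) := by
  induction N with
  | zero =>
    refine ⟨loopTerminates_zero _ _ _, le_of_eq ?_⟩
    rw [show P.outer τ σ β 0 = 0 from rfl, sub_zero]
  | succ N ih =>
    exact ⟨(h.outer_succ_bounds ih.1 ih.2).1, (h.outer_succ_spec ih.1).2.2.2.trans ih.2⟩

theorem IsScaled.loopTerminates (h : P.IsScaled τ σ β q l xs ys ss) (N : ℕ) :
    P.LoopTerminates τ σ β N := (h.loopTerminates_and_qform_le N).1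

theorem IsScaled.innerLength_succ_le (h : P.IsScaled τ σ β q l xs ys ss) (N : ℕ) :
    (P.innerLength τ σ β (N + 1) : ℝ) ≤ 216 * (17 * q ^ 2 * P.Phi xs ss) + 1 :=
  (h.outer_succ_bounds (h.loopTerminates N) (h.loopTerminates_and_qform_le N).2).2.1

theorem IsScaled.outer_succ_dist_le (h : P.IsScaled τ σ β q l xs ys ss) (N : ℕ) :
    euclidNorm ((P.outer τ σ β (N + 1)).1 - xs) +
      euclidNorm (P.Aᵀ *ᵥ ((P.outer τ σ β (N + 1)).2 - ys)) ≤
        17 * P.Phi xs ss * (q * P.outerGap τ σ β (N + 1)) :=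
  (h.outer_succ_bounds (h.loopTerminates N) (h.loopTerminates_and_qform_le N).2).2.2.1

theorem IsScaled.outerGap_nonneg (h : P.IsScaled τ σ β q l xs ys ss) (N : ℕ) :
    0 ≤ P.outerGap τ σ β (N + 1) := (h.outer_succ_spec (h.loopTerminates N)).1

/-- Each restart reduces the normalized gap by the factor `1/e`. -/
theorem IsScaled.outerGap_add_le (h : P.IsScaled τ σ β q l xs ys ss)
    (N K : ℕ) :
    P.outerGap τ σ β (N + 1 + K) ≤
      Real.exp (-K) * P.outerGap τ σ β (N + 1) := by
  induction K with
  | zero => simp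
  | succ K ih =>
    have h1 := (h.loopTerminates (N + K + 1)).outerGap_succ_le
    have hβ0 : 0 ≤ β := by rw [h.β_eq]; positivity
    rw [show N + 1 + (K + 1) = N + K + 2 by ring]
    rw [show N + 1 + K = N + K + 1 by ring] at ih
    calc _ ≤ _ := h1
      _ ≤ β * (Real.exp (-K) * P.outerGap τ σ β (N + 1)) :=
          mul_le_mul_of_nonneg_left ih hβ0
      _ = _ := by
          rw [h.β_eq, ← mul_assoc, one_div, ← Real.exp_neg, ← Real.exp_add]
          push_cast
          ring_nf

theorem IsScaled.totalIter_add_le (h : P.IsScaled τ σ β q l xs ys ss)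
    (N : ℕ) :
    (P.totalIter τ σ β (1 + N) : ℝ) ≤
      1 + N * (216 * (17 * q ^ 2 * P.Phi xs ss) + 1) := by
  induction N with
  | zero => simpa using totalIter_one_le (P := P) τ σ β
  | succ N ih =>
    have h1 := h.innerLength_succ_le N
    rw [← add_assoc, totalIter_succ, add_comm 1 N]
    rw [add_comm 1 N] at ih
    push_cast
    linarith

/-- Everything needed about the outer iterates from the index `N + 1` on, once the distance bound
provided by the normalized gap has become small at the index `N`: the basis is identified, and the
loop length is governed by `‖B⁻¹‖`. -/
theorem IsScaled.local_phase (h : P.IsScaled τ σ β q l xs ys ss) {N : ℕ}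
    (hN : 17 * q ^ 2 * P.Phi xs ss * P.outerGap τ σ β (N + 1) ≤
      xi xs ss / (8 * q)) (K : ℕ) :
    posSupport (P.outer τ σ β (N + 2 + K)).1 = posSupport xs ∧
      (P.innerLength τ σ β (N + 2 + K) : ℝ) ≤
        865 * (q * (q * l) / 2 * ‖P.basisInv (posSupport xs)‖) := by
  have hq := h.q_pos
  have hξ := xi_pos h.two_le_n h.strict
  have hΦ := two_le_Phi h.two_le_n h.strict
  set η := xi xs ss / (4 * q) with hη
  have hη0 : 0 < η := by positivity
  have hη2 : xi xs ss / (8 * q) = η / 2 := by rw [hη]; field_simp; norm_num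
  rw [hη2] at hN
  have hnear : ∀ K, wnorm q (q * l)
      (P.outer τ σ β (N + K + 1) - (xs, ys)) ≤ η / 2 := by
    intro K
    have h1 := h.outer_succ_dist_le (N + K)
    have h2 := h.outerGap_add_le N K
    rw [show N + 1 + K = N + K + 1 by ring] at h2
    have h3 : Real.exp (-K) ≤ 1 := Real.exp_le_one_iff.2 (by simp)
    have h4 := h.outerGap_nonneg N
    have h5 := h2.trans (mul_le_of_le_one_left h4 h3)
    refine (wnorm_le_mul_add h.q_pos h.l_pos h.lower _).trans (le_trans ?_ hN)
    calc q * _ ≤ q * (17 * P.Phi xs ss *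
          (q * P.outerGap τ σ β (N + K + 1))) :=
          mul_le_mul_of_nonneg_left h1 hq.le
      _ ≤ q * (17 * P.Phi xs ss *
          (q * P.outerGap τ σ β (N + 1))) := by gcongr
      _ = _ := by ring
  have e1 := hnear K
  have e2 := hnear (K + 1)
  have ht := h.loopTerminates (N + K + 1)
  obtain ⟨hρ0, -, hgb, -⟩ := h.outer_succ_spec ht
  have hi := avgPDHG_identifies hq h.two_le_sq h.p_pos h.upper h.strict hη0
    (xi_le (xs := xs) (ss := ss)) (by rw [hη]; field_simp; exact le_rfl) e1 ht.one_le
  rw [← h.τ_eq, ← h.σ_eq, ← outer_succ] at hi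
  obtain ⟨i1, i2⟩ := hi
  rw [show N + (K + 1) + 1 = N + K + 1 + 1 by ring] at e2
  rw [show N + 2 + K = N + K + 1 + 1 by ring]
  refine ⟨?_, ?_⟩
  · ext i
    by_cases hi : i ∈ posSupport xs
    · refine iff_of_true ?_ hi
      rw [mem_posSupport]
      have := i2 i hi
      exact pos_of_mul_pos_right (lt_of_lt_of_le (by positivity) this) hq.le
    · refine iff_of_false ?_ hi
      rw [mem_posSupport, i1 i hi]
      exact lt_irrefl _
  · have hr : P.normM τ σ
        (P.outer τ σ β (N + K + 1 + 1) -
          P.outer τ σ β (N + K + 1)) ≤ 4 * η := by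
      refine (h.normM_le _).trans ?_
      have := wnorm_sub_le_add (q := q) (p := q * l)
        (P.outer τ σ β (N + K + 1 + 1)) (xs, ys)
        (P.outer τ σ β (N + K + 1))
      rw [wnorm_sub_comm (xs, ys)] at this
      linarith
    have hd := hgb.local_dist_le hq h.p_pos h.strict h.basis hρ0 hη0 hr i1 i2
    obtain ⟨-, hlen⟩ := h.innerLength_le (by have := h.p_pos; positivity) hd hρ0
    have hone := one_le_mul_norm_basisInv h.basis h.one_le_m h.upper
      (by have := h.p_pos; positivity)
    linarith

theorem dist_pairW_le (x s x' s' : Fin n → ℝ) :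
    dist (pairW x s) (pairW x' s') ≤ euclidNorm (x - x') + euclidNorm (s - s') := by
  have h1 : dist (pairW x s) (pairW x' s') = euclidNorm (Sum.elim (x - x') (s - s')) := by
    rw [dist_eq_norm, euclidNorm]
    congr 1
    ext (i | i) <;> simp [pairW]
  have h2 := euclidNorm_nonneg (x - x')
  have h3 := euclidNorm_nonneg (s - s')
  rw [h1]
  refine le_of_sq_le_sq ?_ (by positivity)
  rw [euclidNorm_sumElim_sq]
  nlinarith

/-- After logarithmically many loops the normalized gap is small enough for the local phase. -/
theorem IsScaled.exists_identification (h : P.IsScaled τ σ β q l xs ys ss) :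
    ∃ N, 17 * q ^ 2 * P.Phi xs ss * P.outerGap τ σ β (N + 1) ≤
        xi xs ss / (8 * q) ∧
      (P.totalIter τ σ β (N + 2) : ℝ) ≤
        170000 * (q ^ 2 / 2 * P.Phi xs ss * Real.log (q ^ 2 / 2 * P.Phi xs ss)) := by
  have hq := h.q_pos
  have hξ := xi_pos h.two_le_n h.strict
  have hΦ := two_le_Phi h.two_le_n h.strict
  have hsq := h.two_le_sq
  set Φ := P.Phi xs ss with hΦdef
  set X := q ^ 2 / 2 * Φ with hX
  have hX2 : 2 ≤ X := by rw [hX]; nlinarith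
  have hlog2 : Real.log 2 ≤ Real.log X := Real.log_le_log (by norm_num) hX2
  have hl2 := Real.log_two_gt_d9
  set M := ⌈Real.log (78336 * X ^ 2)⌉₊ with hM
  -- `78336 = 17 * 144 * 8 * 4` collects the constants of the bounds combined below, and
  -- `78336 ≤ 2 ^ 17`
  have hMlog : Real.log (78336 * X ^ 2) ≤ 19 * Real.log X := by
    have h1 : Real.log (78336 * X ^ 2) ≤ Real.log (X ^ 19) := by
      refine Real.log_le_log (by positivity) ?_
      have : (2 : ℝ) ^ 17 ≤ X ^ 17 := by gcongr
      calc 78336 * X ^ 2 ≤ X ^ 17 * X ^ 2 := by gcongr; linarith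
        _ = X ^ 19 := by ring
    rw [Real.log_pow] at h1
    exact_mod_cast h1
  have hMle : (M : ℝ) ≤ 19 * Real.log X + 1 := by
    refine (Nat.ceil_lt_add_one (Real.log_nonneg ?_)).le.trans (by linarith)
    nlinarith
  have hexp : 78336 * X ^ 2 ≤ Real.exp M := by
    rw [← Real.log_le_iff_le_exp (by positivity)]
    exact Nat.le_ceil _
  refine ⟨M, ?_, ?_⟩
  · have h1 := h.outerGap_add_le 0 M
    rw [zero_add, add_comm 1 M] at h1
    have h2 := (h.outer_succ_bounds (h.loopTerminates 0) (h.loopTerminates_and_qform_le 0).2).2.2.2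
    rw [zero_add] at h2
    have h3 := wnorm_saddle_le hq h.l_pos h.lower h.strict h.orth
    have h4 := sum_le_Phi_mul_xi h.two_le_n h.strict
    have h5 : P.outerGap τ σ β 1 ≤ 144 * (q * (Φ * xi xs ss)) := by
      have := mul_le_mul_of_nonneg_left h4 hq.le
      linarith
    rw [le_div_iff₀ (by positivity)]
    calc 17 * q ^ 2 * Φ * P.outerGap τ σ β (M + 1) * (8 * q)
        ≤ 17 * q ^ 2 * Φ * (Real.exp (-M) * (144 * (q * (Φ * xi xs ss)))) * (8 * q) := by
          gcongr
          exact h1.trans (by gcongr)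
      _ = Real.exp (-M) * (78336 * X ^ 2) * xi xs ss := by rw [hX]; ring
      _ ≤ Real.exp (-M) * Real.exp M * xi xs ss := by gcongr
      _ = xi xs ss := by rw [← Real.exp_add]; simp
  · have h1 := h.totalIter_add_le (M + 1)
    rw [show 1 + (M + 1) = M + 2 by ring] at h1
    refine h1.trans ?_
    have h2 : 216 * (17 * q ^ 2 * Φ) + 1 ≤ 7345 * X := by
      have : 216 * (17 * q ^ 2 * Φ) = 7344 * X := by rw [hX]; ring
      linarith
    have h3 : ((M + 1 : ℕ) : ℝ) ≤ 22 * Real.log X := by push_cast; linarith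
    have h4 : 1 ≤ X * Real.log X := by nlinarith
    have h5 : 0 ≤ Real.log X := by linarith
    calc 1 + ((M + 1 : ℕ) : ℝ) * (216 * (17 * q ^ 2 * Φ) + 1)
        ≤ 1 + 22 * Real.log X * (7345 * X) := by gcongr
      _ ≤ 170000 * (X * Real.log X) := by linarith

end Run

end StdLP

theorem theorem2 :
    ∃ C₁ C₂ : ℝ, 0 < C₁ ∧ 0 < C₂ ∧
      ∀ (m n : ℕ) (_hm : 1 ≤ m) (_hn : 2 ≤ n) (P : StdLP m n)
        (_hrows : LinearIndependent ℝ P.A.row)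
        (xs : Fin n → ℝ) (ys : Fin m → ℝ) (ss : Fin n → ℝ)
        (_hx : P.primalOptimal = {xs}) (_hys : P.dualOptimal = {(ys, ss)})
        (_hAc : P.A *ᵥ P.c = 0)
        (τ σ β : ℝ) (_hτ : τ = 1 / (2 * P.kappa)) (_hσ : σ = 1 / (2 * P.lamMax * P.lamMin))
        (_hβ : β = 1 / Real.exp 1),
        -- the optimal basis matrix is invertible and every inner loop terminates
        (P.basisMap (StdLP.posSupport xs)).IsInvertible ∧
        (∀ N, P.LoopTerminates τ σ β N) ∧
        -- finite-time identification of the optimal basis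
        (∃ N₁, IsLeast {N₀ | ∀ N, N₀ ≤ N →
              StdLP.posSupport (P.outer τ σ β N).1 = StdLP.posSupport xs} N₁ ∧
            (P.totalIter τ σ β N₁ : ℝ) ≤
              C₁ * (P.kappa * P.Phi xs ss * Real.log (P.kappa * P.Phi xs ss))) ∧
        -- fast local convergence
        (∀ ε : ℝ, 0 < ε →
          ∃ N₂, IsLeast {N | P.IsEpsOptimal ε (P.outerW τ σ β N)} N₂ ∧
            (P.totalIter τ σ β N₂ : ℝ) ≤
              C₁ * (P.kappa * P.Phi xs ss * Real.log (P.kappa * P.Phi xs ss)) +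
              C₂ * (‖P.basisInv (StdLP.posSupport xs)‖ * ‖matrixCLM P.A‖ *
                max 0 (Real.log (StdLP.xi xs ss / ε)))) := by
  refine ⟨170000, 865, by norm_num, by norm_num, ?_⟩
  intro m n hm hn P hrows xs ys ss hx hys hAc τ σ β hτ hσ hβ
  have hB := StdLP.basisMap_isInvertible hx hys
  have hl := P.lamMin_pos hm hrows
  have hlL := P.lamMin_le_lamMax hm hrows
  have hLA := P.lamMax_le_norm hm hrows
  have hκ1 : 1 ≤ P.kappa := (one_le_div hl).2 hlL
  have hκL : P.kappa * P.lamMin = P.lamMax := div_mul_cancel₀ _ hl.ne'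
  obtain ⟨q, hq, hqκ⟩ : ∃ q : ℝ, 0 < q ∧ q ^ 2 = 2 * P.kappa :=
    ⟨√(2 * P.kappa), by positivity, Real.sq_sqrt (by positivity)⟩
  have hqL : q * (q * P.lamMin) / 2 = P.lamMax := by
    rw [← hκL]; linear_combination P.lamMin / 2 * hqκ
  have hκq : P.kappa = q ^ 2 / 2 := by rw [hqκ]; ring
  have hs : P.IsScaled τ σ β q P.lamMin xs ys ss :=
    { τ_eq := by rw [hτ, hqκ]
      σ_eq := by rw [hσ, ← hqL]; congr 1; ring
      β_eq := hβ
      one_le_m := hm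
      two_le_n := hn
      q_pos := hq
      two_le_sq := by rw [hqκ]; linarith
      l_pos := hl
      upper := by rw [hqL]; exact P.euclidNorm_mulVec_le_lamMax hm hrows
      lower := P.lamMin_mul_euclidNorm_le hm hrows
      strict := StdLP.isStrictPair_of_unique hx hys
      basis := hB
      orth := hAc }
  rw [hκq]
  obtain ⟨M, hM, htot⟩ := hs.exists_identification
  have hmono := StdLP.totalIter_mono (P := P) τ σ β
  refine ⟨hB, fun N => hs.loopTerminates N, ?_, fun ε hε => ?_⟩
  · set S := {N₀ | ∀ N, N₀ ≤ N → StdLP.posSupport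
      (P.outer τ σ β N).1 = StdLP.posSupport xs} with hS
    have hmem : M + 2 ∈ S := fun N hN => by
      obtain ⟨K, rfl⟩ := Nat.exists_eq_add_of_le hN
      exact (hs.local_phase hM K).1
    refine ⟨sInf S, ⟨Nat.sInf_mem ⟨_, hmem⟩, fun N hN => Nat.sInf_le hN⟩, le_trans ?_ htot⟩
    exact_mod_cast hmono (Nat.sInf_le hmem)
  · set S := {N | P.IsEpsOptimal ε (P.outerW τ σ β N)} with hS
    set ξ := StdLP.xi xs ss with hξ
    have hξ0 : 0 < ξ := StdLP.xi_pos hn hs.strict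
    -- rounding down is compensated by the factor `1/e` that the loop `M + 1` contributes
    set K := ⌊max 0 (Real.log (ξ / ε))⌋₊ with hK
    have hKle : (K : ℝ) ≤ max 0 (Real.log (ξ / ε)) := Nat.floor_le (le_max_left _ _)
    have hmem : M + 2 + K ∈ S := by
      have hopt : P.optimalPairs = {StdLP.pairW xs ss} := by
        ext w
        simp [StdLP.optimalPairs, hx, hys]
      change Metric.infDist _ P.optimalPairs ≤ ε
      rw [hopt, Metric.infDist_singleton]
      refine (StdLP.dist_pairW_le _ _ _ _).trans ?_
      have e1 := hs.outer_succ_dist_le (M + 1 + K)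
      rw [show M + 1 + K + 1 = M + 2 + K by ring] at e1
      have e2 : P.c - P.Aᵀ *ᵥ (P.outer τ σ β (M + 2 + K)).2 - ss =
          -(P.Aᵀ *ᵥ ((P.outer τ σ β (M + 2 + K)).2 - ys)) := by
        rw [← hs.strict.dual, Matrix.mulVec_sub]; abel
      rw [e2, euclidNorm_neg]
      have e3 := hs.outerGap_add_le M (K + 1)
      rw [show M + 1 + (K + 1) = M + 2 + K by ring] at e3
      have hΦ := StdLP.two_le_Phi hn hs.strict
      have e4 : ξ / ε ≤ Real.exp ((K + 1 : ℕ) : ℝ) := by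
        rw [← Real.log_le_iff_le_exp (by positivity)]
        refine (le_max_right 0 _).trans ?_
        push_cast
        exact (Nat.lt_floor_add_one _).le
      have e5 : 17 * P.Phi xs ss *
          (q * P.outerGap τ σ β (M + 1)) ≤ ξ := by
        rw [le_div_iff₀ (by positivity)] at hM
        have hsq := hs.two_le_sq
        have hg := hs.outerGap_nonneg M
        set g := P.outerGap τ σ β (M + 1) with hgdef
        have hpos : 0 ≤ 17 * P.Phi xs ss * (q * g) := by positivity
        nlinarith
      refine e1.trans ?_
      calc 17 * P.Phi xs ss *
            (q * P.outerGap τ σ β (M + 2 + K))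
          ≤ 17 * P.Phi xs ss * (q * (Real.exp (-((K + 1 : ℕ) : ℝ)) *
            P.outerGap τ σ β (M + 1))) := by gcongr
        _ = Real.exp (-((K + 1 : ℕ) : ℝ)) * (17 * P.Phi xs ss *
            (q * P.outerGap τ σ β (M + 1))) := by ring
        _ ≤ Real.exp (-((K + 1 : ℕ) : ℝ)) * ξ := by gcongr
        _ ≤ Real.exp (-((K + 1 : ℕ) : ℝ)) * (Real.exp ((K + 1 : ℕ) : ℝ) * ε) := by
            gcongr
            rwa [div_le_iff₀ hε] at e4
        _ = ε := by rw [← mul_assoc, ← Real.exp_add]; simp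
    refine ⟨sInf S, ⟨Nat.sInf_mem ⟨_, hmem⟩, fun N hN => Nat.sInf_le hN⟩, ?_⟩
    have hlen : ∀ J : ℕ, (P.totalIter τ σ β (M + 2 + J) : ℝ) ≤
        P.totalIter τ σ β (M + 2) +
          J * (865 * (P.lamMax * ‖P.basisInv (StdLP.posSupport xs)‖)) := by
      intro J
      induction J with
      | zero => simp
      | succ J ih =>
        have e1 := (hs.local_phase hM J).2
        rw [hqL] at e1
        rw [← add_assoc, StdLP.totalIter_succ]
        push_cast
        linarith
    have e1 : (P.totalIter τ σ β (sInf S) : ℝ) ≤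
        P.totalIter τ σ β (M + 2 + K) := by
      exact_mod_cast hmono (Nat.sInf_le hmem)
    have hL0 : 0 ≤ P.lamMax := hl.le.trans hlL
    refine (e1.trans (hlen K)).trans (add_le_add htot ?_)
    calc (K : ℝ) * (865 * (P.lamMax * ‖P.basisInv (StdLP.posSupport xs)‖))
        ≤ max 0 (Real.log (ξ / ε)) *
          (865 * (‖matrixCLM P.A‖ * ‖P.basisInv (StdLP.posSupport xs)‖)) := by gcongr
      _ = _ := by ring
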